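/- Let $n\ge 3$, let $\mathbb{R}^n_+=\{x=(x',x_n)\in\mathbb{R}^{n-1}\times\mathbb{R}: x_n>0\}$ and identify $\partial\mathbb{R}^n_+$ with $\mathbb{R}^{n-1}$, both with Lebesgue measure. Let $1<p,q'<\infty$, let $p'$ be the exponent conjugate to $p$ and $q$ the one conjugate to $q'$, and let $\alpha,\beta,\lambda,\mu\in\mathbb{R}$ satisfy $$\lambda\ge 0,\qquad 0<\mu<n-2\lambda,\qquad \frac{\mu-2\lambda}{2n}+\frac{\mu}{2(n-1)}<1,\qquad \frac{n-1}{n}\frac1p+\frac1{q'}\ge 1,$$ $$\frac{n-1}{n}\frac1p+\frac1{q'}+\frac{\alpha+\beta+\mu-\lambda}{n}=\frac{2n-1}{n},$$ $$\alpha<\frac{n-1}{p'},\qquad \beta<\frac nq+\lambda,\qquad \alpha+\beta\ge 0.$$ Put $P_\lambda(x,y,\mu)=x_n^{\lambda}\,(|x'-y|^2+x_n^2)^{-\mu/2}$ for $x\in\mathbb{R}^n_+$, $y\in\partial\mathbb{R}^n_+$, and $$V(f)(x)=\int_{\partial\mathbb{R}^n_+}|y|^{-\alpha}P_\lambda(x,y,\mu)f(y)|x|^{-\beta}\,dy,\qquad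 W(g)(y)=\int_{\mathbb{R}^n_+}|y|^{-\alpha}P_\lambda(x,y,\mu)g(x)|x|^{-\beta}\,dx .$$ Then there is a constant $C>0$ depending only on $n,p,q',\alpha,\beta,\lambda,\mu$ such that for all real-valued $f\in L^p(\partial\mathbb{R}^n_+)$ and $g\in L^{q'}(\mathbb{R}^n_+)$ the following integrals converge absolutely (those defining $V(f)(x)$ and $W(g)(y)$ for almost every $x$ and $y$) and $$\left|\int_{\mathbb{R}^n_+}\int_{\partial\mathbb{R}^n_+}|y|^{-\alpha}P_\lambda(x,y,\mu)f(y)g(x)|x|^{-\beta}\,dy\,dx\right|\le C\,\|f\|_{L^p(\partial\mathbb{R}^n_+)}\|g\|_{L^{q'}(\mathbb{R}^n_+)},\tag{1}$$ $$\|V(f)\|_{L^q(\mathbb{R}^n_+)}\le C\,\|f\|_{L^p(\partial\mathbb{R}^n_+)},\tag{2}$$ $$\|W(g)\|_{L^{p'}(\partial\mathbb{R}^n_+)}\le C\,\|g\|_{L^{q'}(\mathbb{R}^n_+)}.\tag{3}$$ Moreover, for each constant $C>0$, the inequality (1) for all $f,g$, the inequality (2) for all $f$, and the inequality (3) for all $g$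 are equivalent. -/

import Mathlib

open MeasureTheory

noncomputable section

/-- The boundary of the upper half space, `∂ℝⁿ₊ = ℝⁿ⁻¹` with its Euclidean norm. -/
abbrev Bdry (n : ℕ) : Type := EuclideanSpace ℝ (Fin (n - 1))

/-- Points `x = (x', xₙ)` of `ℝⁿ = ℝⁿ⁻¹ × ℝ`. Only measure-theoretic structure is used on this
product (its `volume` is Lebesgue measure); the Euclidean length of a point is `euclNorm`. -/
abbrev Ambient (n : ℕ) : Type := Bdry n × ℝ

/-- The open upper half space `ℝⁿ₊ = {(x', xₙ) : xₙ > 0}`. -/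
def upperHalf (n : ℕ) : Set (Ambient n) := {x | 0 < x.2}

/-- Lebesgue measure on the upper half space. -/
def halfVolume (n : ℕ) : Measure (Ambient n) := volume.restrict (upperHalf n)

/-- The Euclidean length `|x| = (|x'|² + xₙ²)^{1/2}`. -/
def euclNorm {n : ℕ} (x : Ambient n) : ℝ := Real.sqrt (‖x.1‖ ^ 2 + x.2 ^ 2)

/-- The kernel `P_λ(x, y, μ) = xₙ^λ / (|x' - y|² + xₙ²)^{μ/2}`. -/
def kernelP {n : ℕ} (lam μ : ℝ) (x : Ambient n) (y : Bdry n) : ℝ :=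
  x.2 ^ lam / (‖x.1 - y‖ ^ 2 + x.2 ^ 2) ^ (μ / 2)

/-- The doubly weighted kernel `|y|^{-α} P_λ(x, y, μ) |x|^{-β}`. -/
def weightedKernel {n : ℕ} (α β lam μ : ℝ) (x : Ambient n) (y : Bdry n) : ℝ :=
  ‖y‖ ^ (-α) * kernelP lam μ x y * euclNorm x ^ (-β)

/-- `V(f)(x) = ∫_{∂ℝⁿ₊} |y|^{-α} P_λ(x, y, μ) f(y) |x|^{-β} dy`. -/
def opV {n : ℕ} (α β lam μ : ℝ) (f : Bdry n → ℝ) (x : Ambient n) : ℝ :=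
  ∫ y, weightedKernel α β lam μ x y * f y

/-- `W(g)(y) = ∫_{ℝⁿ₊} |y|^{-α} P_λ(x, y, μ) g(x) |x|^{-β} dx`. -/
def opW {n : ℕ} (α β lam μ : ℝ) (g : Ambient n → ℝ) (y : Bdry n) : ℝ :=
  ∫ x, weightedKernel α β lam μ x y * g x ∂(halfVolume n)

/-- The bilinear inequality with constant `C`, for all `f ∈ L^p(∂ℝⁿ₊)` and `g ∈ L^{q'}(ℝⁿ₊)`.
The double integral converges absolutely, and it is bounded by `C ‖f‖_p ‖g‖_{q'}`. -/
def BilinearBound (n : ℕ) (α β lam μ p q' C : ℝ) : Prop :=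
  ∀ (f : Bdry n → ℝ) (g : Ambient n → ℝ),
    MemLp f (ENNReal.ofReal p) volume → MemLp g (ENNReal.ofReal q') (halfVolume n) →
    Integrable (fun z : Ambient n × Bdry n => weightedKernel α β lam μ z.1 z.2 * f z.2 * g z.1)
        ((halfVolume n).prod volume) ∧
      |∫ x, ∫ y, weightedKernel α β lam μ x y * f y * g x ∂volume ∂(halfVolume n)| ≤
        C * (eLpNorm f (ENNReal.ofReal p) volume).toReal *
          (eLpNorm g (ENNReal.ofReal q') (halfVolume n)).toReal

/-- `V` is bounded from `L^p(∂ℝⁿ₊)` to `L^q(ℝⁿ₊)` with constant `C`; the integral defining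
`V(f)(x)` converges absolutely for almost every `x`. -/
def VBound (n : ℕ) (α β lam μ p q C : ℝ) : Prop :=
  ∀ f : Bdry n → ℝ, MemLp f (ENNReal.ofReal p) volume →
    (∀ᵐ x ∂(halfVolume n), Integrable (fun y => weightedKernel α β lam μ x y * f y) volume) ∧
      MemLp (opV α β lam μ f) (ENNReal.ofReal q) (halfVolume n) ∧
      eLpNorm (opV α β lam μ f) (ENNReal.ofReal q) (halfVolume n) ≤
        ENNReal.ofReal C * eLpNorm f (ENNReal.ofReal p) volume

/-- `W` is bounded from `L^{q'}(ℝⁿ₊)` to `L^{p'}(∂ℝⁿ₊)` with constant `C`; the integral defining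
`W(g)(y)` converges absolutely for almost every `y`. -/
def WBound (n : ℕ) (α β lam μ p' q' C : ℝ) : Prop :=
  ∀ g : Ambient n → ℝ, MemLp g (ENNReal.ofReal q') (halfVolume n) →
    (∀ᵐ y : Bdry n, Integrable (fun x => weightedKernel α β lam μ x y * g x) (halfVolume n)) ∧
      MemLp (opW α β lam μ g) (ENNReal.ofReal p') volume ∧
      eLpNorm (opW α β lam μ g) (ENNReal.ofReal p') volume ≤
        ENNReal.ofReal C * eLpNorm g (ENNReal.ofReal q') (halfVolume n)

end

/-! With m = α + β + μ - λ, the scaling condition reads m = (n-1)/p' + n/q, and the weighted kernel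
is homogeneous of degree -m. Let r be the distance from x to y.

Where |y| > 2|x| or |x| > 2|y|, r is comparable to the larger of |x| and |y|, and the kernel is at
most a constant times a Hardy kernel |y|^(-a) |x|^(a-m), with a = α + μ or a = α respectively. The
Hardy forms are bounded because α + μ > (n-1)/p' (this is β < n/q + λ) and α < (n-1)/p'. Where |x|
and |y| are comparable, r ≤ 3|x| and α + β ≥ 0 absorb the weights into r, while xₙ^λ ≤ r^λ; what is
left is the unweighted kernel r^(-m) of Hardy–Littlewood–Sobolev type (`weightedKernel_le`).

All three forms are bounded by the same device, without interpolation or rearrangement. After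
normalisation f = F^(1/p) and g = G^(1/q') with ∫F, ∫G ≤ 1, and the integrand is dominated pointwise
by G(x) a(x,y) + F(y) b(x,y), where ∫ a dy and ∫ b dx are uniformly bounded
(`lintegral_form_le_of_majorant`). The majorants come from Young's inequality in
`hardyLittlewoodSobolev_pointwise_le` and `hardy_pointwise_le`. They may contain the term FG, whose
integral is at most 1.

The equivalence of the three inequalities, with the same constant, is L^p duality for a nonnegative
kernel. Norms on ℝⁿ are sup norms of the product, comparable to the Euclidean length. -/

/-! ### Duality between a bilinear form and its two integral operators. -/

section Duality

variable {X Y : Type*} [MeasurableSpace X] [MeasurableSpace Y]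

theorem eLpNorm_ofReal_eq_lintegral {ν : Measure X} {q : ℝ} (hq : 0 < q) (h : X → ℝ) :
    eLpNorm h (ENNReal.ofReal q) ν = (∫⁻ x, ‖h x‖ₑ ^ q ∂ν) ^ (1 / q) := by
  rw [eLpNorm_eq_lintegral_rpow_enorm_toReal (by simpa using hq) ENNReal.ofReal_ne_top,
    ENNReal.toReal_ofReal hq.le]

theorem abs_integral_mul_le_eLpNorm {ν : Measure X} {q q' : ℝ} (hq : q.HolderConjugate q')
    {h g : X → ℝ} (hh : MemLp h (ENNReal.ofReal q) ν) (hg : MemLp g (ENNReal.ofReal q') ν) :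
    |∫ x, h x * g x ∂ν| ≤
      (eLpNorm h (ENNReal.ofReal q) ν).toReal * (eLpNorm g (ENNReal.ofReal q') ν).toReal := by
  have h1 : ‖∫ x, h x * g x ∂ν‖ₑ ≤
      eLpNorm h (ENNReal.ofReal q) ν * eLpNorm g (ENNReal.ofReal q') ν := by
    rw [eLpNorm_ofReal_eq_lintegral hq.pos, eLpNorm_ofReal_eq_lintegral hq.symm.pos]
    refine (enorm_integral_le_lintegral_enorm _).trans ?_
    simp only [enorm_mul]
    exact ENNReal.lintegral_mul_le_Lp_mul_Lq ν hq hh.1.enorm hg.1.enorm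
  rw [← ENNReal.toReal_mul, ← Real.norm_eq_abs, ← toReal_enorm]
  exact ENNReal.toReal_mono (ENNReal.mul_ne_top hh.2.ne hg.2.ne) h1

/-- The converse of Hölder's inequality. -/
theorem eLpNorm_le_of_forall_abs_integral_mul_le {ν : Measure X} [SigmaFinite ν] {q q' : ℝ}
    (hq : q.HolderConjugate q') {h : X → ℝ} (hh : AEStronglyMeasurable h ν) {M : ℝ} (hM : 0 ≤ M)
    (H : ∀ g : X → ℝ, MemLp g (ENNReal.ofReal q') ν →
      |∫ x, h x * g x ∂ν| ≤ M * (eLpNorm g (ENNReal.ofReal q') ν).toReal) :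
    eLpNorm h (ENNReal.ofReal q) ν ≤ ENNReal.ofReal M := by
  wlog hm : Measurable h generalizing h
  · have e := hh.ae_eq_mk
    rw [eLpNorm_congr_ae e]
    refine this hh.stronglyMeasurable_mk.aestronglyMeasurable (fun g hg => ?_)
      hh.stronglyMeasurable_mk.measurable
    have e' : ∫ x, hh.mk h x * g x ∂ν = ∫ x, h x * g x ∂ν :=
      integral_congr_ae (e.mono fun x hx => by simp only [hx])
    rw [e']
    exact H g hg
  have hq0 := hq.pos
  have hq'0 := hq.symm.pos
  set S : ℕ → Set X := fun N => spanningSets ν N ∩ {x | |h x| ≤ N} with hS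
  have hSm : ∀ N, MeasurableSet (S N) := fun N =>
    (measurableSet_spanningSets ν N).inter (measurableSet_le (by fun_prop) measurable_const)
  have hSmono : Monotone S := fun a b hab x hx =>
    ⟨monotone_spanningSets ν hab hx.1, le_trans (show |h x| ≤ a from hx.2) (Nat.cast_le.2 hab)⟩
  have hSU : ⋃ N, S N = Set.univ := by
    refine Set.eq_univ_of_forall fun x => ?_
    have h1 : x ∈ ⋃ N, spanningSets ν N := by rw [iUnion_spanningSets]; trivial
    obtain ⟨a, ha⟩ := Set.mem_iUnion.1 h1
    obtain ⟨b, hb⟩ := exists_nat_ge |h x|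
    exact Set.mem_iUnion.2 ⟨max a b, monotone_spanningSets ν (le_max_left a b) ha,
      hb.trans (Nat.cast_le.2 (le_max_right a b))⟩
  have key : ∀ N, ∫⁻ x in S N, ‖h x‖ₑ ^ q ∂ν ≤ ENNReal.ofReal M ^ q := by
    intro N
    set J := ∫⁻ x in S N, ‖h x‖ₑ ^ q ∂ν with hJ
    have hJtop : J < ⊤ := by
      refine setLIntegral_lt_top_of_le_nnreal ?_ ⟨(N : NNReal) ^ q, fun x hx => ?_⟩
      · exact ((measure_mono Set.inter_subset_left).trans_lt
          (measure_spanningSets_lt_top ν N)).ne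
      · rw [ENNReal.coe_rpow_of_nonneg _ hq0.le]
        refine ENNReal.rpow_le_rpow ?_ hq0.le
        rw [Real.enorm_eq_ofReal_abs, ENNReal.ofReal_le_iff_le_toReal (by simp)]
        simpa using hx.2
    -- The extremiser sgn(h)|h|^(q-1) of Hölder's inequality, cut off to a set of finite measure on
    -- which h is bounded, so that ∫ h g = ∫ |g|^q' = J is finite.
    set g : X → ℝ := (S N).indicator fun x => h x * |h x| ^ (q - 2) with hg
    have hgm : Measurable g := Measurable.indicator (by fun_prop) (hSm N)
    have hgq : ∫⁻ x, ‖g x‖ₑ ^ q' ∂ν = J := by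
      rw [hJ, ← lintegral_indicator (hSm N)]
      refine lintegral_congr fun x => ?_
      by_cases hx : x ∈ S N
      · simp only [hg, Set.indicator_of_mem hx]
        by_cases h0 : h x = 0
        · simp [h0, hq0, hq'0]
        · rw [Real.enorm_eq_ofReal_abs, Real.enorm_eq_ofReal_abs,
            ENNReal.ofReal_rpow_of_nonneg (abs_nonneg _) hq'0.le,
            ENNReal.ofReal_rpow_of_nonneg (abs_nonneg _) hq0.le, abs_mul,
            abs_of_nonneg (Real.rpow_nonneg (abs_nonneg (h x)) _)]
          have hp : 0 < |h x| := abs_pos.2 h0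
          have e1 : |h x| * |h x| ^ (q - 2) = |h x| ^ (q - 1) := by
            conv_lhs => rw [← Real.rpow_one_add' hp.le (by linarith [hq.lt])]
            congr 1; ring
          rw [e1, ← Real.rpow_mul hp.le, hq.sub_one_mul_conj]
      · simp [hg, Set.indicator_of_notMem hx, hq'0]
    have hgn : eLpNorm g (ENNReal.ofReal q') ν = J ^ (1 / q') := by
      rw [eLpNorm_ofReal_eq_lintegral hq'0, hgq]
    have hgL : MemLp g (ENNReal.ofReal q') ν := by
      refine ⟨hgm.aestronglyMeasurable, ?_⟩
      rw [hgn]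
      exact ENNReal.rpow_lt_top_of_nonneg (by positivity) hJtop.ne
    have hint : ∫ x, h x * g x ∂ν = J.toReal := by
      have e : ∀ x, h x * g x = (‖(S N).indicator h x‖ₑ ^ q).toReal := by
        intro x
        by_cases hx : x ∈ S N
        · simp only [hg, Set.indicator_of_mem hx]
          by_cases h0 : h x = 0
          · simp [h0, hq0]
          · have hp : 0 < |h x| := abs_pos.2 h0
            rw [← ENNReal.toReal_rpow, toReal_enorm, Real.norm_eq_abs, ← mul_assoc,
              ← abs_mul_abs_self, mul_assoc]
            have : |h x| ^ q = |h x| ^ ((1:ℝ) + (1 + (q - 2))) := by congr 1; ring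
            rw [this, Real.rpow_add hp, Real.rpow_add hp, Real.rpow_one]
        · simp [hg, Set.indicator_of_notMem hx, hq0]
      simp only [e]
      rw [integral_toReal]
      · congr 1
        rw [hJ, ← lintegral_indicator (hSm N)]
        refine lintegral_congr fun x => ?_
        by_cases hx : x ∈ S N <;> simp [hx, hq0]
      · have : Measurable ((S N).indicator h) := hm.indicator (hSm N)
        fun_prop
      · refine Filter.Eventually.of_forall fun x => ?_
        exact ENNReal.rpow_lt_top_of_nonneg hq0.le enorm_ne_top
    have h1 := H g hgL
    rw [hint, hgn, abs_of_nonneg ENNReal.toReal_nonneg, ← ENNReal.toReal_rpow] at h1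
    set j := J.toReal with hj
    have hj0 : 0 ≤ j := ENNReal.toReal_nonneg
    rw [← ENNReal.ofReal_toReal hJtop.ne, ENNReal.ofReal_rpow_of_nonneg hM hq0.le]
    refine ENNReal.ofReal_le_ofReal ?_
    rw [← hj]
    rcases hj0.eq_or_lt with h0 | h0
    · rw [← h0]; positivity
    -- The hypothesis at g says J ≤ M J^(1/q'); since J is finite and positive, J^(1/q') can be
    -- cancelled.
    · have h2 : j ^ (1 / q) ≤ M := by
        have e : j = j ^ (1 / q) * j ^ (1 / q') := by
          rw [← Real.rpow_add h0, one_div, one_div, hq.inv_add_inv_eq_one, Real.rpow_one]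
        rw [e] at h1
        rw [← e] at h1
        nth_rewrite 1 [e] at h1
        exact le_of_mul_le_mul_right h1 (by positivity)
      calc j = (j ^ (1 / q)) ^ q := by
            rw [← Real.rpow_mul hj0, one_div_mul_cancel hq0.ne', Real.rpow_one]
        _ ≤ M ^ q := Real.rpow_le_rpow (by positivity) h2 hq0.le
  rw [eLpNorm_ofReal_eq_lintegral hq0]
  have hall : ∫⁻ x, ‖h x‖ₑ ^ q ∂ν ≤ ENNReal.ofReal M ^ q := by
    rw [← setLIntegral_univ, ← hSU, setLIntegral_iUnion_of_directed _ hSmono.directed_le]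
    exact iSup_le key
  calc (∫⁻ x, ‖h x‖ₑ ^ q ∂ν) ^ (1 / q) ≤ (ENNReal.ofReal M ^ q) ^ (1 / q) := by gcongr
    _ = ENNReal.ofReal M := by
      rw [← ENNReal.rpow_mul, mul_one_div_cancel hq0.ne', ENNReal.rpow_one]

/-- The bilinear form with kernel `k` converges absolutely on `L^p × L^{q'}` and is bounded
by `C`. -/
def IsBoundedForm (ν : Measure X) (ρ : Measure Y) (k : X → Y → ℝ) (p q' C : ℝ) : Prop :=
  ∀ (f : Y → ℝ) (g : X → ℝ),
    MemLp f (ENNReal.ofReal p) ρ → MemLp g (ENNReal.ofReal q') ν →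
    Integrable (fun z : X × Y => k z.1 z.2 * f z.2 * g z.1) (ν.prod ρ) ∧
      |∫ x, ∫ y, k x y * f y * g x ∂ρ ∂ν| ≤
        C * (eLpNorm f (ENNReal.ofReal p) ρ).toReal * (eLpNorm g (ENNReal.ofReal q') ν).toReal

/-- The integral operator with kernel `k` is bounded by `C` from `L^p` to `L^q`. -/
def IsBoundedIntegralOperator (ν : Measure X) (ρ : Measure Y) (k : X → Y → ℝ) (p q C : ℝ) : Prop :=
  ∀ f : Y → ℝ, MemLp f (ENNReal.ofReal p) ρ →
    (∀ᵐ x ∂ν, Integrable (fun y => k x y * f y) ρ) ∧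
      MemLp (fun x => ∫ y, k x y * f y ∂ρ) (ENNReal.ofReal q) ν ∧
      eLpNorm (fun x => ∫ y, k x y * f y ∂ρ) (ENNReal.ofReal q) ν ≤
        ENNReal.ofReal C * eLpNorm f (ENNReal.ofReal p) ρ

theorem exists_pos_memLp (ν : Measure X) [SigmaFinite ν] {q : ℝ} (hq : 0 < q) :
    ∃ g : X → ℝ, (∀ x, 0 < g x) ∧ MemLp g (ENNReal.ofReal q) ν := by
  obtain ⟨g, hg0, hgm, hg⟩ := exists_pos_lintegral_lt_of_sigmaFinite ν (ε := 1) one_ne_zero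
  refine ⟨fun x => (g x : ℝ) ^ (1 / q), fun x => Real.rpow_pos_of_pos (by exact_mod_cast hg0 x) _,
    (hgm.coe_nnreal_real.pow_const _).aestronglyMeasurable, ?_⟩
  rw [eLpNorm_ofReal_eq_lintegral hq]
  refine ENNReal.rpow_lt_top_of_nonneg (by positivity) (ne_of_lt ?_)
  refine lt_of_eq_of_lt (lintegral_congr fun x => ?_) (hg.trans ENNReal.one_lt_top)
  rw [Real.enorm_of_nonneg (by positivity), ENNReal.ofReal_rpow_of_nonneg (by positivity) hq.le,
    ← Real.rpow_mul (by positivity), one_div_mul_cancel hq.ne', Real.rpow_one]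
  simp

theorem IsBoundedForm.isBoundedIntegralOperator {ν : Measure X} {ρ : Measure Y} [SigmaFinite ν]
    [SFinite ρ] {k : X → Y → ℝ} (hk : Measurable (Function.uncurry k)) {p q q' C : ℝ}
    (hq : q.HolderConjugate q') (hC : 0 ≤ C) (H : IsBoundedForm ν ρ k p q' C) :
    IsBoundedIntegralOperator ν ρ k p q C := by
  intro f hf
  have hkf : AEStronglyMeasurable (fun z : X × Y => k z.1 z.2 * f z.2) (ν.prod ρ) :=
    hk.aestronglyMeasurable.mul hf.1.comp_snd
  have hle : eLpNorm (fun x => ∫ y, k x y * f y ∂ρ) (ENNReal.ofReal q) ν ≤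
      ENNReal.ofReal C * eLpNorm f (ENNReal.ofReal p) ρ := by
    rw [← ENNReal.ofReal_toReal hf.2.ne, ← ENNReal.ofReal_mul hC]
    refine eLpNorm_le_of_forall_abs_integral_mul_le hq hkf.integral_prod_right'
      (by positivity) fun g hg => ?_
    simpa only [integral_mul_const] using (H f g hf hg).2
  refine ⟨?_, ⟨hkf.integral_prod_right', hle.trans_lt ?_⟩, hle⟩
  -- Fubini for one strictly positive g makes k(x,·) f g(x) integrable for almost every x, and the
  -- factor g(x) divides out.
  · obtain ⟨g, hg0, hg⟩ := exists_pos_memLp ν hq.symm.pos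
    filter_upwards [(H f g hf hg).1.prod_right_ae] with x hx
    simpa [mul_assoc, mul_inv_cancel₀ (hg0 x).ne'] using hx.mul_const (g x)⁻¹
  · exact ENNReal.mul_lt_top ENNReal.ofReal_lt_top hf.2

theorem IsBoundedIntegralOperator.isBoundedForm {ν : Measure X} {ρ : Measure Y} [SFinite ν]
    [SFinite ρ] {k : X → Y → ℝ} (hk : Measurable (Function.uncurry k))
    (hk0 : ∀ᵐ z ∂ν.prod ρ, 0 ≤ k z.1 z.2) {p q q' C : ℝ}
    (hq : q.HolderConjugate q') (hC : 0 ≤ C) (H : IsBoundedIntegralOperator ν ρ k p q C) :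
    IsBoundedForm ν ρ k p q' C := by
  intro f g hf hg
  constructor
  -- Absolute convergence comes from the operator applied to |f|: as k ≥ 0, its value at x is ∫
  -- |k(x,y) f(y)| dy, which lies in L^q and pairs with |g|.
  · obtain ⟨h1, h2, -⟩ := H _ hf.norm
    have hm : AEStronglyMeasurable (fun z : X × Y => k z.1 z.2 * f z.2 * g z.1) (ν.prod ρ) :=
      (hk.aestronglyMeasurable.mul hf.1.comp_snd).mul hg.1.comp_fst
    rw [integrable_prod_iff hm]
    constructor
    · filter_upwards [(H f hf).1] with x hx using hx.mul_const _
    · have : ENNReal.HolderTriple (ENNReal.ofReal q) (ENNReal.ofReal q') 1 :=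
        hq.ennrealOfReal
      refine (h2.integrable_mul hg.norm).congr ?_
      filter_upwards [Measure.ae_ae_of_ae_prod hk0] with x hx
      simp only [Pi.mul_apply]
      rw [← integral_mul_const]
      refine integral_congr_ae ?_
      filter_upwards [hx] with y hy
      rw [norm_mul, norm_mul, Real.norm_of_nonneg hy]
  · obtain ⟨-, h2, h3⟩ := H f hf
    simp only [integral_mul_const]
    refine (abs_integral_mul_le_eLpNorm hq h2 hg).trans ?_
    refine mul_le_mul_of_nonneg_right ?_ ENNReal.toReal_nonneg
    rw [← ENNReal.toReal_ofReal hC, ← ENNReal.toReal_mul]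
    exact ENNReal.toReal_mono (ENNReal.mul_ne_top ENNReal.ofReal_ne_top hf.2.ne) h3

theorem isBoundedForm_swap {ν : Measure X} {ρ : Measure Y} [SFinite ν] [SFinite ρ]
    {k : X → Y → ℝ} {p q' C : ℝ} (H : IsBoundedForm ν ρ k p q' C) :
    IsBoundedForm ρ ν (fun y x => k x y) q' p C := by
  intro g f hg hf
  obtain ⟨h1, h2⟩ := H f g hf hg
  have h3 : Integrable (fun z : Y × X => k z.2 z.1 * g z.2 * f z.1) (ρ.prod ν) :=
    h1.swap.congr (Filter.Eventually.of_forall fun z => mul_right_comm _ _ _)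
  refine ⟨h3, ?_⟩
  rw [integral_integral_swap (by exact h3)]
  simpa only [mul_right_comm] using h2

theorem isBoundedForm_iff_isBoundedIntegralOperator {ν : Measure X} {ρ : Measure Y}
    [SigmaFinite ν] [SFinite ρ] {k : X → Y → ℝ} (hk : Measurable (Function.uncurry k))
    (hk0 : ∀ᵐ z ∂ν.prod ρ, 0 ≤ k z.1 z.2) {p q q' C : ℝ}
    (hq : q.HolderConjugate q') (hC : 0 ≤ C) :
    IsBoundedForm ν ρ k p q' C ↔ IsBoundedIntegralOperator ν ρ k p q C :=
  ⟨fun H => H.isBoundedIntegralOperator hk hq hC, fun H => H.isBoundedForm hk hk0 hq hC⟩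

theorem isBoundedForm_iff_isBoundedIntegralOperator_swap {ν : Measure X} {ρ : Measure Y}
    [SFinite ν] [SigmaFinite ρ] {k : X → Y → ℝ} (hk : Measurable (Function.uncurry k))
    (hk0 : ∀ᵐ z ∂ν.prod ρ, 0 ≤ k z.1 z.2) {p p' q' C : ℝ}
    (hp : p.HolderConjugate p') (hC : 0 ≤ C) :
    IsBoundedForm ν ρ k p q' C ↔ IsBoundedIntegralOperator ρ ν (fun y x => k x y) q' p' C := by
  have hk0' : ∀ᵐ z ∂ρ.prod ν, 0 ≤ k z.2 z.1 := by
    rw [← Measure.prod_swap] at hk0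
    exact ae_of_ae_map measurable_swap.aemeasurable hk0
  rw [← isBoundedForm_iff_isBoundedIntegralOperator (k := fun y x => k x y) (hk.comp measurable_swap) hk0' hp.symm hC]
  exact ⟨isBoundedForm_swap, isBoundedForm_swap⟩

end Duality

/-! ### Integrals of powers of the norm over balls and their complements. -/

section Radial

variable {E : Type*} [NormedAddCommGroup E] [NormedSpace ℝ E] [FiniteDimensional ℝ E]
  [Nontrivial E]

theorem pow_finrank_sub_one_mul_rpow {y : ℝ} (hy : 0 < y) (b : ℝ) :
    y ^ (Module.finrank ℝ E - 1) * y ^ (-b) = y ^ ((Module.finrank ℝ E : ℝ) - 1 - b) := by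
  rw [← Real.rpow_natCast, ← Real.rpow_add hy, Nat.cast_sub Module.finrank_pos]
  congr 1
  push_cast
  ring

variable [MeasurableSpace E] [BorelSpace E] (ν : Measure E) [ν.IsAddHaarMeasure]

theorem lintegral_ofReal_radial {φ : ℝ → ℝ} (h0 : ∀ r, 0 ≤ r → 0 ≤ φ r)
    (hφ : IntegrableOn (fun y : ℝ => y ^ (Module.finrank ℝ E - 1) * φ y) (Set.Ioi 0)) (a : E) :
    ∫⁻ x, ENNReal.ofReal (φ ‖x - a‖) ∂ν =
      ENNReal.ofReal (Module.finrank ℝ E * ν.real (Metric.ball 0 1) *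
        ∫ y in Set.Ioi (0 : ℝ), y ^ (Module.finrank ℝ E - 1) * φ y) := by
  rw [lintegral_sub_right_eq_self (fun x => ENNReal.ofReal (φ ‖x‖)) a,
    ← ofReal_integral_eq_lintegral_ofReal ((integrable_fun_norm_addHaar ν).2 hφ)
      (.of_forall fun x => h0 _ (norm_nonneg x)), integral_fun_norm_addHaar]
  simp [nsmul_eq_mul, mul_assoc]

theorem exists_lintegral_norm_rpow_closedBall_le {b : ℝ} (hb : b < Module.finrank ℝ E) :
    ∃ C : ℝ, 0 ≤ C ∧ ∀ ρ : ℝ, 0 < ρ → ∀ a : E,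
      ∫⁻ x, ENNReal.ofReal (if ‖x - a‖ ≤ ρ then ‖x - a‖ ^ (-b) else 0) ∂ν ≤
        ENNReal.ofReal (C * ρ ^ ((Module.finrank ℝ E : ℝ) - b)) := by
  have hD : (0 : ℝ) < (Module.finrank ℝ E : ℝ) - b := by linarith
  refine ⟨Module.finrank ℝ E * ν.real (Metric.ball 0 1) / ((Module.finrank ℝ E : ℝ) - b),
    by positivity, fun ρ hρ a => ?_⟩
  have e : Set.EqOn
      (fun y : ℝ => y ^ (Module.finrank ℝ E - 1) * (if y ≤ ρ then y ^ (-b) else 0))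
      ((Set.Ioc 0 ρ).indicator fun y => y ^ ((Module.finrank ℝ E : ℝ) - 1 - b)) (Set.Ioi 0) := by
    intro y hy
    by_cases h : y ≤ ρ
    · simp [Set.indicator, h, Set.mem_Ioi.1 hy, pow_finrank_sub_one_mul_rpow (E := E) hy]
    · simp [Set.indicator, h]
  have hi : IntegrableOn (fun y : ℝ => y ^ ((Module.finrank ℝ E : ℝ) - 1 - b)) (Set.Ioc 0 ρ) :=
    (intervalIntegral.intervalIntegrable_rpow' (by linarith)).1
  rw [lintegral_ofReal_radial ν (φ := fun r => if r ≤ ρ then r ^ (-b) else 0)]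
  · rw [setIntegral_congr_fun measurableSet_Ioi e, setIntegral_indicator measurableSet_Ioc,
      Set.inter_eq_right.2 Set.Ioc_subset_Ioi_self, ← intervalIntegral.integral_of_le hρ.le,
      integral_rpow (by left; linarith), Real.zero_rpow (by linarith)]
    refine le_of_eq (congrArg _ ?_)
    rw [show (Module.finrank ℝ E : ℝ) - 1 - b + 1 = Module.finrank ℝ E - b by ring]
    ring
  · intro r hr
    split_ifs with h
    · positivity
    · rfl
  · rw [integrableOn_congr_fun e measurableSet_Ioi, integrableOn_indicator_iff measurableSet_Ioc]
    exact hi.mono_set (by simp)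

theorem exists_lintegral_norm_rpow_compl_ball_le {b : ℝ} (hb : (Module.finrank ℝ E : ℝ) < b) :
    ∃ C : ℝ, 0 ≤ C ∧ ∀ ρ : ℝ, 0 < ρ → ∀ a : E,
      ∫⁻ x, ENNReal.ofReal (if ρ < ‖x - a‖ then ‖x - a‖ ^ (-b) else 0) ∂ν ≤
        ENNReal.ofReal (C * ρ ^ ((Module.finrank ℝ E : ℝ) - b)) := by
  have hD : (0 : ℝ) < b - (Module.finrank ℝ E : ℝ) := by linarith
  refine ⟨Module.finrank ℝ E * ν.real (Metric.ball 0 1) / (b - (Module.finrank ℝ E : ℝ)),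
    by positivity, fun ρ hρ a => ?_⟩
  have e : Set.EqOn
      (fun y : ℝ => y ^ (Module.finrank ℝ E - 1) * (if ρ < y then y ^ (-b) else 0))
      ((Set.Ioi ρ).indicator fun y => y ^ ((Module.finrank ℝ E : ℝ) - 1 - b)) (Set.Ioi 0) := by
    intro y hy
    by_cases h : ρ < y
    · simp [Set.indicator, h, pow_finrank_sub_one_mul_rpow (E := E) hy]
    · simp [Set.indicator, h]
  have hi : IntegrableOn (fun y : ℝ => y ^ ((Module.finrank ℝ E : ℝ) - 1 - b)) (Set.Ioi ρ) :=
    integrableOn_Ioi_rpow_of_lt (by linarith) hρ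
  rw [lintegral_ofReal_radial ν (φ := fun r => if ρ < r then r ^ (-b) else 0)]
  · rw [setIntegral_congr_fun measurableSet_Ioi e, setIntegral_indicator measurableSet_Ioi,
      Set.inter_eq_right.2 (Set.Ioi_subset_Ioi hρ.le), integral_Ioi_rpow_of_lt (by linarith) hρ]
    refine le_of_eq (congrArg _ ?_)
    rw [show (Module.finrank ℝ E : ℝ) - 1 - b + 1 = -(b - Module.finrank ℝ E) by ring,
      show (Module.finrank ℝ E : ℝ) - b = -(b - Module.finrank ℝ E) by ring, neg_div_neg_eq]
    ring
  · intro r hr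
    split_ifs with h
    · have := hρ.trans h
      positivity
    · rfl
  · rw [integrableOn_congr_fun e measurableSet_Ioi, integrableOn_indicator_iff measurableSet_Ioi]
    exact hi.mono_set (by simp)

end Radial

/-! ### Bounded forms on normalised densities. -/

section UnitForm

variable {X Y : Type*} [MeasurableSpace X] [MeasurableSpace Y]

/-- The form with kernel `k` is bounded on pairs of nonnegative functions `F ^ (1 / p)` and
`G ^ (1 / q')` in the unit balls of `L^p` and `L^{q'}`. -/
def UnitFormBounded (ν : Measure X) (ρ : Measure Y) (p q' : ℝ) (k : X → Y → ℝ) : Prop :=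
  ∃ C : ℝ, 0 ≤ C ∧ ∀ (F : Y → ℝ) (G : X → ℝ), Measurable F → Measurable G →
    (∀ y, 0 ≤ F y) → (∀ x, 0 ≤ G x) →
    ∫⁻ y, ENNReal.ofReal (F y) ∂ρ ≤ 1 → ∫⁻ x, ENNReal.ofReal (G x) ∂ν ≤ 1 →
    ∫⁻ x, ∫⁻ y, ENNReal.ofReal (k x y * F y ^ (1 / p) * G x ^ (1 / q')) ∂ρ ∂ν ≤
      ENNReal.ofReal C

variable {ν : Measure X} {ρ : Measure Y} {p q' : ℝ}

theorem UnitFormBounded.of_le_mul {k l : X → Y → ℝ} (hk : UnitFormBounded ν ρ p q' k) {c : ℝ}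
    (hc : 0 ≤ c) (h : ∀ᵐ x ∂ν, ∀ᵐ y ∂ρ, l x y ≤ c * k x y) : UnitFormBounded ν ρ p q' l := by
  obtain ⟨C, hC, h1⟩ := hk
  refine ⟨c * C, by positivity, fun F G hF hG hF0 hG0 hFi hGi => ?_⟩
  rw [ENNReal.ofReal_mul hc]
  refine le_trans ?_ (mul_le_mul_right (h1 F G hF hG hF0 hG0 hFi hGi) _)
  rw [← lintegral_const_mul' _ _ ENNReal.ofReal_ne_top]
  refine lintegral_mono_ae (h.mono fun x hx => ?_)
  rw [← lintegral_const_mul' _ _ ENNReal.ofReal_ne_top]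
  refine lintegral_mono_ae (hx.mono fun y hy => ?_)
  rw [← ENNReal.ofReal_mul hc]
  refine ENNReal.ofReal_le_ofReal ?_
  have hf := hF0 y
  have hg := hG0 x
  calc l x y * F y ^ (1 / p) * G x ^ (1 / q') ≤ c * k x y * F y ^ (1 / p) * G x ^ (1 / q') := by
        gcongr
    _ = _ := by ring

theorem lintegral_abs_div_rpow_le_one {Z : Type*} [MeasurableSpace Z] {σ : Measure Z} {s c : ℝ}
    {h h' : Z → ℝ} (hs : 0 < s) (hc : 0 < c) (hh : h =ᵐ[σ] h')
    (he : eLpNorm h (ENNReal.ofReal s) σ = ENNReal.ofReal c) :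
    ∫⁻ z, ENNReal.ofReal ((|h' z| / c) ^ s) ∂σ ≤ 1 := by
  rw [eLpNorm_congr_ae hh, eLpNorm_ofReal_eq_lintegral hs] at he
  have e : ∀ z, ENNReal.ofReal ((|h' z| / c) ^ s) =
      ENNReal.ofReal ((c ^ s)⁻¹) * ‖h' z‖ₑ ^ s := by
    intro z
    rw [Real.enorm_eq_ofReal_abs, ENNReal.ofReal_rpow_of_nonneg (abs_nonneg _) hs.le,
      ← ENNReal.ofReal_mul (by positivity), Real.div_rpow (abs_nonneg _) hc.le]
    congr 1
    ring
  simp only [e]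
  rw [lintegral_const_mul' _ _ ENNReal.ofReal_ne_top]
  have : ∫⁻ z, ‖h' z‖ₑ ^ s ∂σ = ENNReal.ofReal (c ^ s) := by
    rw [← ENNReal.ofReal_rpow_of_nonneg hc.le hs.le, ← he, ← ENNReal.rpow_mul,
      one_div_mul_cancel hs.ne', ENNReal.rpow_one]
  rw [this, ← ENNReal.ofReal_mul (by positivity), inv_mul_cancel₀ (by positivity)]
  simp

/-- Homogeneity: the densities (|f|/‖f‖_p)^p and (|g|/‖g‖_q')^q' have mass 1. Measurable
representatives are substituted because the unit form is tested only on measurable functions; a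
vanishing norm is treated apart. -/
theorem UnitFormBounded.exists_lintegral_enorm_le {k : X → Y → ℝ} (hp : 0 < p) (hq : 0 < q')
    (H : UnitFormBounded ν ρ p q' fun x y => |k x y|) :
    ∃ C : ℝ, 0 < C ∧ ∀ (f : Y → ℝ) (g : X → ℝ),
      MemLp f (ENNReal.ofReal p) ρ → MemLp g (ENNReal.ofReal q') ν →
      ∫⁻ x, ∫⁻ y, ‖k x y * f y * g x‖ₑ ∂ρ ∂ν ≤
        ENNReal.ofReal (C * (eLpNorm f (ENNReal.ofReal p) ρ).toReal *
          (eLpNorm g (ENNReal.ofReal q') ν).toReal) := by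
  obtain ⟨C, hC, H⟩ := H
  -- The added 1 only makes the constant strictly positive.
  refine ⟨C + 1, by positivity, fun f g hf hg => ?_⟩
  have hp' : ENNReal.ofReal p ≠ 0 := by simpa using hp
  have hq'' : ENNReal.ofReal q' ≠ 0 := by simpa using hq
  set A := (eLpNorm f (ENNReal.ofReal p) ρ).toReal with hA
  set B := (eLpNorm g (ENNReal.ofReal q') ν).toReal with hB
  rcases (ENNReal.toReal_nonneg : 0 ≤ A).eq_or_lt with h0 | hA0
  · have : f =ᵐ[ρ] 0 := by
      rw [← eLpNorm_eq_zero_iff hf.1 hp']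
      exact ((ENNReal.toReal_eq_zero_iff _).1 h0.symm).resolve_right hf.2.ne
    refine le_of_eq_of_le ?_ zero_le
    refine lintegral_eq_zero_of_ae_eq_zero (.of_forall fun x => ?_)
    refine lintegral_eq_zero_of_ae_eq_zero (this.mono fun y hy => ?_)
    simp [hy]
  rcases (ENNReal.toReal_nonneg : 0 ≤ B).eq_or_lt with h0 | hB0
  · have : g =ᵐ[ν] 0 := by
      rw [← eLpNorm_eq_zero_iff hg.1 hq'']
      exact ((ENNReal.toReal_eq_zero_iff _).1 h0.symm).resolve_right hg.2.ne
    refine le_of_eq_of_le ?_ zero_le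
    refine lintegral_eq_zero_of_ae_eq_zero (this.mono fun x hx => ?_)
    simp [hx]
  replace hA0 : 0 < A := hA0
  replace hB0 : 0 < B := hB0
  have h1 := H (fun y => (|hf.1.mk f y| / A) ^ p) (fun x => (|hg.1.mk g x| / B) ^ q')
    (by have := hf.1.stronglyMeasurable_mk.measurable
        exact (this.abs.div_const _).pow_const _)
    (by have := hg.1.stronglyMeasurable_mk.measurable
        exact (this.abs.div_const _).pow_const _)
    (fun y => by positivity) (fun x => by positivity)
    (lintegral_abs_div_rpow_le_one hp hA0 hf.1.ae_eq_mk (ENNReal.ofReal_toReal hf.2.ne).symm)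
    (lintegral_abs_div_rpow_le_one hq hB0 hg.1.ae_eq_mk (ENNReal.ofReal_toReal hg.2.ne).symm)
  calc ∫⁻ x, ∫⁻ y, ‖k x y * f y * g x‖ₑ ∂ρ ∂ν
      = ENNReal.ofReal (A * B) * ∫⁻ x, ∫⁻ y, ENNReal.ofReal (|k x y| *
          ((|hf.1.mk f y| / A) ^ p) ^ (1 / p) * ((|hg.1.mk g x| / B) ^ q') ^ (1 / q')) ∂ρ ∂ν := by
        rw [← lintegral_const_mul' _ _ ENNReal.ofReal_ne_top]
        refine lintegral_congr_ae (hg.1.ae_eq_mk.mono fun x hx => ?_)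
        dsimp only
        rw [← lintegral_const_mul' _ _ ENNReal.ofReal_ne_top]
        refine lintegral_congr_ae (hf.1.ae_eq_mk.mono fun y hy => ?_)
        dsimp only
        rw [← ENNReal.ofReal_mul (by positivity), ← Real.rpow_mul (by positivity),
          ← Real.rpow_mul (by positivity), mul_one_div_cancel hp.ne', mul_one_div_cancel hq.ne',
          Real.rpow_one, Real.rpow_one, Real.enorm_eq_ofReal_abs, abs_mul, abs_mul, hx, hy]
        congr 1
        field_simp
    _ ≤ ENNReal.ofReal (A * B) * ENNReal.ofReal C := mul_le_mul_right h1 _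
    _ ≤ _ := by
        rw [← ENNReal.ofReal_mul (by positivity)]
        refine ENNReal.ofReal_le_ofReal ?_
        nlinarith [mul_pos hA0 hB0]

variable [SFinite ρ]

theorem UnitFormBounded.add {k l : X → Y → ℝ} (hk : UnitFormBounded ν ρ p q' k)
    (hl : UnitFormBounded ν ρ p q' l) (hm : Measurable (Function.uncurry k)) :
    UnitFormBounded ν ρ p q' (fun x y => k x y + l x y) := by
  obtain ⟨C, hC, h1⟩ := hk
  obtain ⟨D, hD, h2⟩ := hl
  refine ⟨C + D, by positivity, fun F G hF hG hF0 hG0 hFi hGi => ?_⟩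
  rw [ENNReal.ofReal_add hC hD]
  refine le_trans ?_ (add_le_add (h1 F G hF hG hF0 hG0 hFi hGi) (h2 F G hF hG hF0 hG0 hFi hGi))
  have hm1 : Measurable (Function.uncurry fun x y =>
      ENNReal.ofReal (k x y * F y ^ (1 / p) * G x ^ (1 / q'))) :=
    ENNReal.measurable_ofReal.comp
      ((hm.mul ((hF.pow_const _).comp measurable_snd)).mul ((hG.pow_const _).comp measurable_fst))
  rw [← lintegral_add_left hm1.lintegral_prod_right]
  refine lintegral_mono fun x => ?_
  have hx : Measurable fun y => ENNReal.ofReal (k x y * F y ^ (1 / p) * G x ^ (1 / q')) :=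
    hm1.of_uncurry_left
  rw [← lintegral_add_left hx]
  refine lintegral_mono fun y => ?_
  rw [add_mul, add_mul]
  exact ENNReal.ofReal_add_le

theorem UnitFormBounded.exists_isBoundedForm {k : X → Y → ℝ}
    (hk : Measurable (Function.uncurry k)) (hp : 0 < p) (hq : 0 < q')
    (H : UnitFormBounded ν ρ p q' fun x y => |k x y|) :
    ∃ C : ℝ, 0 < C ∧ IsBoundedForm ν ρ k p q' C := by
  obtain ⟨C, hC, H⟩ := H.exists_lintegral_enorm_le hp hq
  refine ⟨C, hC, fun f g hf hg => ?_⟩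
  have h1 := H f g hf hg
  have hm : AEStronglyMeasurable (fun z : X × Y => k z.1 z.2 * f z.2 * g z.1) (ν.prod ρ) :=
    (hk.aestronglyMeasurable.mul hf.1.comp_snd).mul hg.1.comp_fst
  refine ⟨⟨hm, ?_⟩, ?_⟩
  · rw [HasFiniteIntegral, lintegral_prod _ hm.enorm]
    exact h1.trans_lt ENNReal.ofReal_lt_top
  · rw [← Real.norm_eq_abs, ← toReal_enorm]
    refine ENNReal.toReal_le_of_le_ofReal (by positivity) (le_trans ?_ h1)
    exact (enorm_integral_le_lintegral_enorm _).trans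
      (lintegral_mono fun x => enorm_integral_le_lintegral_enorm _)

variable [SFinite ν]

/-- A form is bounded as soon as its integrand is dominated by `G x * a x y + F y * b x y` with
uniformly bounded marginal integrals of `a` and `b`. -/
theorem lintegral_form_le_of_majorant (hp : 0 < p) (hq : 0 < q') {k a b : X → Y → ℝ} {F : Y → ℝ}
    {G : X → ℝ} (hF : Measurable F)
    (hF0 : ∀ y, 0 ≤ F y) (hG0 : ∀ x, 0 ≤ G x)
    (hFi : ∫⁻ y, ENNReal.ofReal (F y) ∂ρ ≤ 1) (hGi : ∫⁻ x, ENNReal.ofReal (G x) ∂ν ≤ 1)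
    (hb : Measurable (Function.uncurry b)) {A B : ℝ} (hA : 0 ≤ A) (hB : 0 ≤ B)
    (hle : ∀ᵐ x ∂ν, ∀ᵐ y ∂ρ, 0 < F y → 0 < G x →
      k x y * F y ^ (1 / p) * G x ^ (1 / q') ≤ G x * a x y + F y * b x y)
    (hai : ∀ᵐ x ∂ν, 0 < G x → ∫⁻ y, ENNReal.ofReal (a x y) ∂ρ ≤ ENNReal.ofReal A)
    (hbi : ∀ᵐ y ∂ρ, 0 < F y → ∫⁻ x, ENNReal.ofReal (b x y) ∂ν ≤ ENNReal.ofReal B) :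
    ∫⁻ x, ∫⁻ y, ENNReal.ofReal (k x y * F y ^ (1 / p) * G x ^ (1 / q')) ∂ρ ∂ν ≤
      ENNReal.ofReal (A + B) := by
  have hm : Measurable (Function.uncurry fun x y =>
      ENNReal.ofReal (F y) * ENNReal.ofReal (b x y)) :=
    ((ENNReal.measurable_ofReal.comp hF).comp measurable_snd).mul
      (ENNReal.measurable_ofReal.comp hb)
  have h1 : ∫⁻ x, ∫⁻ y, ENNReal.ofReal (k x y * F y ^ (1 / p) * G x ^ (1 / q')) ∂ρ ∂ν ≤
      ∫⁻ x, (ENNReal.ofReal (G x) * ∫⁻ y, ENNReal.ofReal (a x y) ∂ρ) +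
        ∫⁻ y, ENNReal.ofReal (F y) * ENNReal.ofReal (b x y) ∂ρ ∂ν := by
    refine lintegral_mono_ae (hle.mono fun x hx => ?_)
    have hm' : Measurable fun y => ENNReal.ofReal (F y) * ENNReal.ofReal (b x y) :=
      hm.of_uncurry_left
    rw [← lintegral_const_mul' _ _ ENNReal.ofReal_ne_top, ← lintegral_add_right _ hm']
    refine lintegral_mono_ae (hx.mono fun y hy => ?_)
    rcases (hF0 y).eq_or_lt with hf | hf
    · simp [← hf, Real.zero_rpow (inv_ne_zero hp.ne')]
    rcases (hG0 x).eq_or_lt with hg | hg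
    · simp [← hg, Real.zero_rpow (inv_ne_zero hq.ne')]
    rw [← ENNReal.ofReal_mul hf.le, ← ENNReal.ofReal_mul hg.le]
    exact (ENNReal.ofReal_le_ofReal (hy hf hg)).trans ENNReal.ofReal_add_le
  refine h1.trans ?_
  rw [lintegral_add_right _ hm.lintegral_prod_right, lintegral_lintegral_swap hm.aemeasurable,
    ENNReal.ofReal_add hA hB]
  refine add_le_add ?_ ?_
  · calc ∫⁻ x, ENNReal.ofReal (G x) * ∫⁻ y, ENNReal.ofReal (a x y) ∂ρ ∂ν
        ≤ ∫⁻ x, ENNReal.ofReal (G x) * ENNReal.ofReal A ∂ν := by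
          refine lintegral_mono_ae (hai.mono fun x hx => ?_)
          rcases (hG0 x).eq_or_lt with hg | hg
          · simp [← hg]
          · exact mul_le_mul_right (hx hg) _
      _ ≤ 1 * ENNReal.ofReal A := by
          rw [lintegral_mul_const' _ _ ENNReal.ofReal_ne_top]
          exact mul_le_mul_left hGi _
      _ = _ := one_mul _
  · calc ∫⁻ y, ∫⁻ x, ENNReal.ofReal (F y) * ENNReal.ofReal (b x y) ∂ν ∂ρ
        ≤ ∫⁻ y, ENNReal.ofReal (F y) * ENNReal.ofReal B ∂ρ := by
          refine lintegral_mono_ae (hbi.mono fun y hy => ?_)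
          rw [lintegral_const_mul' _ _ ENNReal.ofReal_ne_top]
          rcases (hF0 y).eq_or_lt with hf | hf
          · simp [← hf]
          · exact mul_le_mul_right (hy hf) _
      _ ≤ 1 * ENNReal.ofReal B := by
          rw [lintegral_mul_const' _ _ ENNReal.ofReal_ne_top]
          exact mul_le_mul_left hFi _
      _ = _ := one_mul _

end UnitForm

/-! ### Pointwise majorants from Young's inequality, in logarithmic coordinates. -/

section Pointwise

/-- Young's inequality after taking logarithms: a weighted mean is at most the maximum. With every
quantity written as an exponential, checking exponents becomes linear algebra. -/
theorem exp_convex_comb_le {w₁ w₂ a b : ℝ} (h₁ : 0 ≤ w₁) (h₂ : 0 ≤ w₂) (hw : w₁ + w₂ = 1) :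
    Real.exp (w₁ * a + w₂ * b) ≤ Real.exp a + Real.exp b := by
  have h : w₁ * a + w₂ * b ≤ max a b := by
    calc w₁ * a + w₂ * b ≤ w₁ * max a b + w₂ * max a b := by gcongr <;> simp
      _ = max a b := by rw [← add_mul, hw, one_mul]
  refine (Real.exp_le_exp.2 h).trans ?_
  rcases max_cases a b with h | h <;> rw [h.1] <;> linarith [Real.exp_pos a, Real.exp_pos b]

theorem exp_convex_comb_le₃ {w₁ w₂ w₃ a b c : ℝ} (h₁ : 0 ≤ w₁) (h₂ : 0 ≤ w₂) (h₃ : 0 ≤ w₃)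
    (hw : w₁ + w₂ + w₃ = 1) :
    Real.exp (w₁ * a + w₂ * b + w₃ * c) ≤ Real.exp a + Real.exp b + Real.exp c := by
  have h : w₁ * a + w₂ * b + w₃ * c ≤ max (max a b) c := by
    calc w₁ * a + w₂ * b + w₃ * c
        ≤ w₁ * max (max a b) c + w₂ * max (max a b) c + w₃ * max (max a b) c := by
          gcongr <;> simp
      _ = max (max a b) c := by rw [← add_mul, ← add_mul, hw, one_mul]
  refine (Real.exp_le_exp.2 h).trans ?_
  rcases max_cases (max a b) c with h | h <;> rcases max_cases a b with h' | h' <;>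
    rw [h.1] <;> (try rw [h'.1]) <;>
    linarith [Real.exp_pos a, Real.exp_pos b, Real.exp_pos c]

theorem exists_exp_mul_eq {x d : ℝ} (hx : 0 < x) (hd : d ≠ 0) : ∃ z, x = Real.exp (d * z) :=
  ⟨Real.log x / d, by rw [mul_div_cancel₀ _ hd, Real.exp_log hx]⟩

/-- Pointwise domination of the integrand of the Hardy–Littlewood–Sobolev form on the half space:
`r` is the distance from a point at height `t` to a boundary point. -/
theorem hardyLittlewoodSobolev_pointwise_le {n d p p' q q' m κ c ε F G r t : ℝ}
    (hp : p.HolderConjugate p') (hq : q.HolderConjugate q') (hd : 0 < d) (hn : 0 < n)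
    (hm : m = d / p' + n / q) (hκ : 0 ≤ κ) (hc : 0 < c) (hcκ : c = n / q' - κ)
    (hε : ε * c = d / p * κ) (hF : 0 < F) (hG : 0 < G) (ht : 0 < t) (htr : t ≤ r) :
    r ^ (-m) * F ^ (1 / p) * G ^ (1 / q') ≤
      G * (F + ((if G ^ (-1 / n) < r then (G ^ (-1 / n)) ^ (m * p' - d) * r ^ (-(m * p')) else 0) +
        (if r ≤ G ^ (-1 / n) then (G ^ (-1 / n)) ^ (-(d - (m - ε))) * r ^ (-(m - ε)) else 0))) +
      F * ((if F ^ (-1 / d) < r then (F ^ (-1 / d)) ^ (m * q - n) * r ^ (-(m * q)) else 0) +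
        (if r ≤ F ^ (-1 / d) then
          (F ^ (-1 / d)) ^ (-(n - (m + κ))) * (t ^ (-(κ + ε)) * r ^ (-(m - ε))) else 0)) := by
  obtain ⟨Z, rfl⟩ := exists_exp_mul_eq hF hd.ne'
  obtain ⟨W, rfl⟩ := exists_exp_mul_eq hG hn.ne'
  obtain ⟨R, hR⟩ : ∃ R, r = Real.exp R := ⟨_, (Real.exp_log (ht.trans_le htr)).symm⟩
  obtain ⟨T, hT⟩ : ∃ T, t = Real.exp T := ⟨_, (Real.exp_log ht).symm⟩
  have eZ : Real.exp (d * Z) ^ (-1 / d) = Real.exp (-Z) := by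
    rw [← Real.exp_mul]; congr 1; field_simp
  have eW : Real.exp (n * W) ^ (-1 / n) = Real.exp (-W) := by
    rw [← Real.exp_mul]; congr 1; field_simp
  rw [eZ, eW]
  set T₁ := if Real.exp (-W) < r then Real.exp (-W) ^ (m * p' - d) * r ^ (-(m * p')) else 0
    with hT₁
  set T₂ := if Real.exp (-Z) < r then Real.exp (-Z) ^ (m * q - n) * r ^ (-(m * q)) else 0
    with hT₂
  set T₃ := if r ≤ Real.exp (-W) then Real.exp (-W) ^ (-(d - (m - ε))) * r ^ (-(m - ε)) else 0
    with hT₃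
  set T₄ := if r ≤ Real.exp (-Z) then
    Real.exp (-Z) ^ (-(n - (m + κ))) * (t ^ (-(κ + ε)) * r ^ (-(m - ε))) else 0 with hT₄
  have hr0 : 0 < r := ht.trans_le htr
  have p1 : 0 ≤ T₁ := by rw [hT₁]; split_ifs <;> positivity
  have p2 : 0 ≤ T₂ := by rw [hT₂]; split_ifs <;> positivity
  have p3 : 0 ≤ T₃ := by rw [hT₃]; split_ifs <;> positivity
  have p4 : 0 ≤ T₄ := by rw [hT₄]; split_ifs <;> positivity
  have hTR : T ≤ R := by rw [hT, hR] at htr; exact Real.exp_le_exp.1 htr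
  have hip : 1 / p + 1 / p' = 1 := by simpa using hp.inv_add_inv_eq_one
  have hiq : 1 / q + 1 / q' = 1 := by simpa using hq.inv_add_inv_eq_one
  have hpp : 1 / p' * p' = 1 := one_div_mul_cancel hp.symm.ne_zero
  have hqq : 1 / q * q = 1 := one_div_mul_cancel hq.ne_zero
  have ip0 := hp.one_div_pos
  have ip'0 := hp.symm.one_div_pos
  have iq0 := hq.one_div_pos
  have iq'0 := hq.symm.one_div_pos
  rw [div_eq_mul_one_div d p', div_eq_mul_one_div n q] at hm
  rw [div_eq_mul_one_div n q'] at hcκ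
  rw [div_eq_mul_one_div d p] at hε
  generalize 1 / p = i at *
  generalize 1 / p' = i' at *
  generalize 1 / q = j at *
  generalize 1 / q' = j' at *
  have hε0 : 0 ≤ ε := by
    by_contra! h
    have : ε * c < 0 := mul_neg_of_neg_of_pos h hc
    have : 0 ≤ d * i * κ := by positivity
    linarith
  have eL : r ^ (-m) * Real.exp (d * Z) ^ i * Real.exp (n * W) ^ j' =
      Real.exp (-(m * R) + d * i * Z + n * j' * W) := by
    rw [hR, ← Real.exp_mul, ← Real.exp_mul, ← Real.exp_mul, ← Real.exp_add, ← Real.exp_add]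
    congr 1; ring
  rw [eL]
  have q1 := mul_nonneg (Real.exp_pos (n * W)).le p1
  have q2 := mul_nonneg (Real.exp_pos (d * Z)).le p2
  have q3 := mul_nonneg (Real.exp_pos (n * W)).le p3
  have q4 := mul_nonneg (Real.exp_pos (d * Z)).le p4
  have q0 := mul_pos (Real.exp_pos (n * W)) (Real.exp_pos (d * Z))
  -- Beyond the length G^(-1/n), the integrand is the geometric mean of GF and G times the tail
  -- term, with weights 1/p and 1/p'.
  by_cases c1 : Real.exp (-W) < r
  · have e : -(m * R) + d * i * Z + n * j' * W =
        i * (n * W + d * Z) + i' * (n * W + ((-W) * (m * p' - d) + R * (-(m * p')))) := by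
      subst hm
      linear_combination (-n * W) * hip + (W + R) * (d * i' + n * j) * hpp + n * W * hiq
    have h := exp_convex_comb_le (a := n * W + d * Z)
      (b := n * W + ((-W) * (m * p' - d) + R * (-(m * p')))) ip0.le ip'0.le hip
    rw [if_pos c1, hR, ← Real.exp_mul, ← Real.exp_mul, ← Real.exp_add] at hT₁
    rw [← e, Real.exp_add (n * W) (d * Z), Real.exp_add (n * W) (_ + _), ← hT₁] at h
    linarith
  -- Beyond F^(-1/d), the same with GF and F times the other tail term, with weights 1/q' and 1/q.
  by_cases c2 : Real.exp (-Z) < r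
  · have e : -(m * R) + d * i * Z + n * j' * W =
        j' * (n * W + d * Z) + j * (d * Z + ((-Z) * (m * q - n) + R * (-(m * q)))) := by
      subst hm
      linear_combination (d * Z) * hip + (Z + R) * (d * i' + n * j) * hqq - d * Z * hiq
    have h := exp_convex_comb_le (a := n * W + d * Z)
      (b := d * Z + ((-Z) * (m * q - n) + R * (-(m * q)))) iq'0.le iq0.le (by linarith)
    rw [if_pos c2, hR, ← Real.exp_mul, ← Real.exp_mul, ← Real.exp_add] at hT₂
    rw [← e, Real.exp_add (n * W) (d * Z), Real.exp_add (d * Z) (_ + _), ← hT₂] at h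
    linarith
  rw [if_pos (not_lt.1 c1)] at hT₃
  rw [if_pos (not_lt.1 c2)] at hT₄
  have hεTR : ε * T ≤ ε * R := mul_le_mul_of_nonneg_left hTR hε0
  -- Now r is below both lengths, and the threshold is G^(1/q') ≤ F^(c/d) t^(-κ). If it holds, it
  -- replaces G^(1/q'), and r^(-ε) ≤ t^(-ε). If it fails, F^(1/p) ≤ G^((d/p+ε)/n) t^ε and t^ε ≤ r^ε;
  -- the relation ε c = (d/p) κ is what makes the power of t equal to ε.
  by_cases c3 : n * j' * W ≤ c * Z - κ * T
  · have h : -(m * R) + d * i * Z + n * j' * W ≤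
        d * Z + ((-Z) * (-(n - (m + κ))) + (T * (-(κ + ε)) + R * (-(m - ε)))) := by
      subst hm
      subst hcκ
      have e1 : i' = 1 - i := by linarith
      have e2 : j' = 1 - j := by linarith
      subst e1 e2
      linarith
    have h := Real.exp_le_exp.2 h
    rw [Real.exp_add (d * Z), Real.exp_add (_ * _), Real.exp_add (T * _), Real.exp_mul (-Z),
      Real.exp_mul T, Real.exp_mul R, ← hR, ← hT, ← hT₄] at h
    linarith
  · have h : -(m * R) + d * i * Z + n * j' * W ≤
        n * W + ((-W) * (-(d - (m - ε))) + R * (-(m - ε))) := by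
      have h1 : d * i * Z ≤ (d * i + ε) * W + ε * T := by
        refine le_of_mul_le_mul_left ?_ hc
        have h2 := mul_le_mul_of_nonneg_left (not_le.1 c3).le (by positivity : 0 ≤ d * i)
        have h3 : c * ((d * i + ε) * W + ε * T) = d * i * (n * j' * W + κ * T) := by
          subst hcκ
          linear_combination (W + T) * hε
        rw [h3]
        linarith
      subst hm
      have e1 : i' = 1 - i := by linarith
      have e2 : j' = 1 - j := by linarith
      subst e1 e2
      linarith
    have h := Real.exp_le_exp.2 h
    rw [Real.exp_add (n * W), Real.exp_add (_ * _), Real.exp_mul (-W),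
      Real.exp_mul R, ← hR, ← hT₃] at h
    linarith

/-- Pointwise domination of the integrand of a Hardy type form with the homogeneous kernel
`s ^ (-a) * r ^ (a - m)`. -/
theorem hardy_pointwise_le {n d p p' q q' m a δ F G r s : ℝ}
    (hp : p.HolderConjugate p') (hq : q.HolderConjugate q') (hpq : 1 / q ≤ 1 / p)
    (hm : m = d / p' + n / q) (hF : 0 < F) (hG : 0 < G) (hr : 0 < r) (hs : 0 < s)
    (hδ : s ^ (δ * p) ≤ r ^ (δ * p)) :
    s ^ (-a) * r ^ (a - m) * F ^ (1 / p) * G ^ (1 / q') ≤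
      G * (F + r ^ ((a + δ) * p' - d) * s ^ (-((a + δ) * p'))) +
      F * (s ^ (δ * p) * r ^ (-(n + δ * p))) := by
  obtain ⟨U, rfl⟩ : ∃ R, F = Real.exp R := ⟨_, (Real.exp_log hF).symm⟩
  obtain ⟨V, rfl⟩ : ∃ R, G = Real.exp R := ⟨_, (Real.exp_log hG).symm⟩
  obtain ⟨R, rfl⟩ : ∃ R, r = Real.exp R := ⟨_, (Real.exp_log hr).symm⟩
  obtain ⟨S, rfl⟩ : ∃ R, s = Real.exp R := ⟨_, (Real.exp_log hs).symm⟩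
  have hip : 1 / p + 1 / p' = 1 := by simpa using hp.inv_add_inv_eq_one
  have hiq : 1 / q + 1 / q' = 1 := by simpa using hq.inv_add_inv_eq_one
  have hpp : 1 / p' * p' = 1 := one_div_mul_cancel hp.symm.ne_zero
  have hpp' : 1 / p * p = 1 := one_div_mul_cancel hp.ne_zero
  have ip'0 := hp.symm.one_div_pos
  have iq0 := hq.one_div_pos
  rw [div_eq_mul_one_div d p', div_eq_mul_one_div n q] at hm
  simp only [← Real.exp_mul, ← Real.exp_add, mul_add, Real.exp_le_exp] at hδ ⊢
  generalize 1 / p = i at *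
  generalize 1 / p' = i' at *
  generalize 1 / q = j at *
  generalize 1 / q' = j' at *
  -- The weights 1/p - 1/q, 1/p', 1/q sum to 1, and the powers of s/r introduced by δ cancel in the
  -- mean. The first term is FG (s/r)^(δp), at most FG by `hδ`.
  have h := exp_convex_comb_le₃ (a := V + (U + (S * (δ * p) - R * (δ * p))))
    (b := V + (R * ((a + δ) * p' - d) + S * (-((a + δ) * p'))))
    (c := U + (S * (δ * p) + R * (-(n + δ * p)))) (sub_nonneg.2 hpq) ip'0.le iq0.le (by linarith)
  have h2 : Real.exp (V + (U + (S * (δ * p) - R * (δ * p)))) ≤ Real.exp (V + U) :=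
    Real.exp_le_exp.2 (by linarith)
  refine le_trans (le_of_eq ?_) (h.trans ?_)
  · congr 1
    subst hm
    linear_combination (R - S) * δ * hpp' + (S - R) * (a + δ) * hpp + V * hiq - V * hip
  · linarith

end Pointwise

/-! ### Integrals of powers of the distance to a boundary point. -/

section HalfSpaceIntegrals

/-- The distance between a point of `ℝⁿ` and a boundary point in the product (supremum) norm. -/
noncomputable def bdryDist {n : ℕ} (x : Ambient n) (y : Bdry n) : ℝ := max ‖x.1 - y‖ |x.2|

theorem measurable_bdryDist {n : ℕ} :
    Measurable (Function.uncurry (bdryDist : Ambient n → Bdry n → ℝ)) := by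
  unfold bdryDist Function.uncurry
  fun_prop

theorem bdryDist_eq_norm {n : ℕ} (x : Ambient n) (y : Bdry n) : bdryDist x y = ‖x - (y, 0)‖ := by
  simp [bdryDist, Prod.norm_def]

instance {n : ℕ} : (volume : Measure (Ambient n)).IsAddHaarMeasure := by
  rw [Measure.volume_eq_prod]
  infer_instance

instance {n : ℕ} : SigmaFinite (halfVolume n) := by
  unfold halfVolume
  infer_instance

theorem measurableSet_upperHalf (n : ℕ) : MeasurableSet (upperHalf n) :=
  measurableSet_lt measurable_const measurable_snd

theorem ae_halfVolume_pos (n : ℕ) : ∀ᵐ x ∂halfVolume n, 0 < x.2 :=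
  ae_restrict_mem (measurableSet_upperHalf n)

theorem nontrivial_bdry {n : ℕ} (hn : 2 ≤ n) : Nontrivial (Bdry n) := by
  have : NeZero (n - 1) := ⟨by omega⟩
  infer_instance

theorem finrank_bdry {n : ℕ} (hn : 2 ≤ n) : (Module.finrank ℝ (Bdry n) : ℝ) = n - 1 := by
  rw [finrank_euclideanSpace_fin, Nat.cast_sub (by omega), Nat.cast_one]

theorem finrank_ambient {n : ℕ} (hn : 2 ≤ n) : (Module.finrank ℝ (Ambient n) : ℝ) = n := by
  rw [Module.finrank_prod, Nat.cast_add, finrank_bdry hn]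
  simp

/-- For b ≥ 0, raising the distance to max(‖y - a‖, |s|) only shrinks both the integrand and the
ball, so the bound at s = 0 is uniform in s. -/
theorem exists_lintegral_max_norm_rpow_le {n : ℕ} (hn : 2 ≤ n) {b : ℝ} (hb0 : 0 ≤ b)
    (hb : b < (n : ℝ) - 1) :
    ∃ C : ℝ, 0 ≤ C ∧ ∀ ρ : ℝ, 0 < ρ → ∀ (a : Bdry n) (s : ℝ),
      ∫⁻ y : Bdry n, ENNReal.ofReal
        (if max ‖y - a‖ |s| ≤ ρ then (max ‖y - a‖ |s|) ^ (-b) else 0) ≤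
        ENNReal.ofReal (C * ρ ^ ((n : ℝ) - 1 - b)) := by
  have := nontrivial_bdry hn
  obtain ⟨C, hC, h⟩ := exists_lintegral_norm_rpow_closedBall_le (volume : Measure (Bdry n)) (b := b)
    (by rwa [finrank_bdry hn])
  rw [finrank_bdry hn] at h
  refine ⟨C, hC, fun ρ hρ a s => le_trans (lintegral_mono_ae ?_) (h ρ hρ a)⟩
  filter_upwards [Measure.ae_ne volume a] with y hy
  refine ENNReal.ofReal_le_ofReal ?_
  have hy0 : 0 < ‖y - a‖ := norm_pos_iff.2 (sub_ne_zero.2 hy)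
  by_cases h1 : max ‖y - a‖ |s| ≤ ρ
  · rw [if_pos h1, if_pos ((le_max_left _ _).trans h1)]
    exact Real.rpow_le_rpow_of_nonpos hy0 (le_max_left _ _) (by linarith)
  · rw [if_neg h1]
    split_ifs <;> positivity

theorem exists_lintegral_bdryDist_le {n : ℕ} (hn : 2 ≤ n) {b : ℝ} (hb0 : 0 ≤ b)
    (hb : b < (n : ℝ) - 1) :
    ∃ C : ℝ, 0 ≤ C ∧ ∀ ρ : ℝ, 0 < ρ → ∀ x : Ambient n,
      ∫⁻ y : Bdry n, ENNReal.ofReal (if bdryDist x y ≤ ρ then bdryDist x y ^ (-b) else 0) ≤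
        ENNReal.ofReal (C * ρ ^ ((n : ℝ) - 1 - b)) := by
  obtain ⟨C, hC, h⟩ := exists_lintegral_max_norm_rpow_le hn hb0 hb
  refine ⟨C, hC, fun ρ hρ x => ?_⟩
  simpa only [bdryDist, norm_sub_rev x.1] using h ρ hρ x.1 x.2

/-- A point y at distance more than ρ from x may still have ‖y - x'‖ ≤ ρ, when x is high. On that
ball the integrand is at most ρ^(-b), and the case b = 0 of the ball estimate supplies the volume.
-/
theorem exists_lintegral_bdryDist_tail_le {n : ℕ} (hn : 2 ≤ n) {b : ℝ} (hb : (n : ℝ) - 1 < b) :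
    ∃ C : ℝ, 0 ≤ C ∧ ∀ ρ : ℝ, 0 < ρ → ∀ x : Ambient n,
      ∫⁻ y : Bdry n, ENNReal.ofReal (if ρ < bdryDist x y then bdryDist x y ^ (-b) else 0) ≤
        ENNReal.ofReal (C * ρ ^ ((n : ℝ) - 1 - b)) := by
  have := nontrivial_bdry hn
  have hn' : (2 : ℝ) ≤ n := by exact_mod_cast hn
  obtain ⟨C, hC, h⟩ := exists_lintegral_norm_rpow_compl_ball_le (volume : Measure (Bdry n)) (b := b)
    (by rwa [finrank_bdry hn])
  obtain ⟨D, hD, h'⟩ := exists_lintegral_norm_rpow_closedBall_le (volume : Measure (Bdry n))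
    (b := 0) (by rw [finrank_bdry hn]; linarith)
  rw [finrank_bdry hn] at h h'
  refine ⟨C + D, by positivity, fun ρ hρ x => ?_⟩
  have hle : ∀ y : Bdry n,
      ENNReal.ofReal (if ρ < bdryDist x y then bdryDist x y ^ (-b) else 0) ≤
      ENNReal.ofReal (if ρ < ‖y - x.1‖ then ‖y - x.1‖ ^ (-b) else 0) + ENNReal.ofReal (ρ ^ (-b)) *
        ENNReal.ofReal (if ‖y - x.1‖ ≤ ρ then ‖y - x.1‖ ^ (-(0 : ℝ)) else 0) := by
    intro y
    by_cases h1 : ρ < bdryDist x y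
    · rw [if_pos h1]
      rcases lt_or_ge ρ ‖y - x.1‖ with h2 | h2
      · rw [if_pos h2]
        refine le_trans (ENNReal.ofReal_le_ofReal ?_) le_self_add
        refine Real.rpow_le_rpow_of_nonpos (hρ.trans h2) ?_ (by linarith)
        rw [norm_sub_rev]
        exact le_max_left _ _
      · rw [if_pos h2, neg_zero, Real.rpow_zero, ENNReal.ofReal_one, mul_one]
        refine le_trans (ENNReal.ofReal_le_ofReal ?_) le_add_self
        exact Real.rpow_le_rpow_of_nonpos hρ h1.le (by linarith)
    · simp [h1]
  calc _ ≤ ∫⁻ y : Bdry n, (ENNReal.ofReal (if ρ < ‖y - x.1‖ then ‖y - x.1‖ ^ (-b) else 0) +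
        ENNReal.ofReal (ρ ^ (-b)) *
        ENNReal.ofReal (if ‖y - x.1‖ ≤ ρ then ‖y - x.1‖ ^ (-(0 : ℝ)) else 0)) := lintegral_mono hle
    _ ≤ ENNReal.ofReal (C * ρ ^ ((n : ℝ) - 1 - b)) + ENNReal.ofReal (ρ ^ (-b)) *
        ENNReal.ofReal (D * ρ ^ ((n : ℝ) - 1 - 0)) := by
      rw [lintegral_add_left, lintegral_const_mul' _ _ ENNReal.ofReal_ne_top]
      · exact add_le_add (h ρ hρ x.1) (mul_le_mul_right (h' ρ hρ x.1) _)
      · refine ENNReal.measurable_ofReal.comp (Measurable.ite ?_ ?_ measurable_const)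
        · exact measurableSet_lt measurable_const (by fun_prop)
        · exact Measurable.pow_const (by fun_prop) _
    _ = _ := by
      rw [← ENNReal.ofReal_mul (by positivity), ← ENNReal.ofReal_add (by positivity)
        (by positivity), sub_zero, sub_eq_add_neg _ b, Real.rpow_add hρ]
      congr 1
      ring

theorem exists_lintegral_halfVolume_bdryDist_tail_le {n : ℕ} (hn : 2 ≤ n) {b : ℝ}
    (hb : (n : ℝ) < b) :
    ∃ C : ℝ, 0 ≤ C ∧ ∀ ρ : ℝ, 0 < ρ → ∀ y : Bdry n,
      ∫⁻ x, ENNReal.ofReal (if ρ < bdryDist x y then bdryDist x y ^ (-b) else 0) ∂halfVolume n ≤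
        ENNReal.ofReal (C * ρ ^ ((n : ℝ) - b)) := by
  have := nontrivial_bdry hn
  obtain ⟨C, hC, h⟩ := exists_lintegral_norm_rpow_compl_ball_le (volume : Measure (Ambient n))
    (b := b) (by rwa [finrank_ambient hn])
  rw [finrank_ambient hn] at h
  refine ⟨C, hC, fun ρ hρ y => (lintegral_mono' Measure.restrict_le_self le_rfl).trans ?_⟩
  simpa only [bdryDist_eq_norm] using h ρ hρ (y, 0)

/-- Tonelli in the height: the horizontal slices are bounded uniformly, and a < 1 makes the
remaining power of xₙ integrable at 0. -/
theorem exists_lintegral_halfVolume_bdryDist_le {n : ℕ} (hn : 2 ≤ n) {a b : ℝ}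
    (ha : a < 1) (hb0 : 0 ≤ b) (hb : b < (n : ℝ) - 1) :
    ∃ C : ℝ, 0 ≤ C ∧ ∀ ρ : ℝ, 0 < ρ → ∀ y : Bdry n,
      ∫⁻ x, ENNReal.ofReal
        (if bdryDist x y ≤ ρ then x.2 ^ (-a) * bdryDist x y ^ (-b) else 0) ∂halfVolume n ≤
        ENNReal.ofReal (C * ρ ^ ((n : ℝ) - a - b)) := by
  obtain ⟨C, hC, h⟩ := exists_lintegral_max_norm_rpow_le hn hb0 hb
  obtain ⟨D, hD, h'⟩ := exists_lintegral_norm_rpow_closedBall_le (volume : Measure ℝ) (b := a)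
    (by simpa using ha)
  simp only [Module.finrank_self, Nat.cast_one] at h'
  refine ⟨C * D, by positivity, fun ρ hρ y => ?_⟩
  have hm : Measurable fun x : Ambient n =>
      ENNReal.ofReal (if ‖x.2 - 0‖ ≤ ρ then ‖x.2 - 0‖ ^ (-a) else 0) *
      ENNReal.ofReal (if max ‖x.1 - y‖ |x.2| ≤ ρ then (max ‖x.1 - y‖ |x.2|) ^ (-b) else 0) := by
    refine (ENNReal.measurable_ofReal.comp (Measurable.ite ?_ ?_ measurable_const)).mul
      (ENNReal.measurable_ofReal.comp (Measurable.ite ?_ ?_ measurable_const))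
    · exact measurableSet_le (by fun_prop) measurable_const
    · exact Measurable.pow_const (by fun_prop) _
    · exact measurableSet_le (by fun_prop) measurable_const
    · exact Measurable.pow_const (by fun_prop) _
  calc _ ≤ ∫⁻ x, ENNReal.ofReal (if ‖x.2 - 0‖ ≤ ρ then ‖x.2 - 0‖ ^ (-a) else 0) *
      ENNReal.ofReal (if max ‖x.1 - y‖ |x.2| ≤ ρ then (max ‖x.1 - y‖ |x.2|) ^ (-b) else 0)
        ∂halfVolume n := by
        refine lintegral_mono_ae ((ae_halfVolume_pos n).mono fun x hx => ?_)
        by_cases h1 : bdryDist x y ≤ ρ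
        · have h2 : |x.2| ≤ ρ := (le_max_right _ _).trans h1
          have h3 : max ‖x.1 - y‖ |x.2| ≤ ρ := h1
          rw [if_pos h1, if_pos h3, sub_zero, Real.norm_eq_abs, if_pos h2, abs_of_pos hx,
            ENNReal.ofReal_mul (by positivity), bdryDist, abs_of_pos hx]
        · simp [h1]
    _ ≤ ∫⁻ x : Ambient n, ENNReal.ofReal (if ‖x.2 - 0‖ ≤ ρ then ‖x.2 - 0‖ ^ (-a) else 0) *
      ENNReal.ofReal (if max ‖x.1 - y‖ |x.2| ≤ ρ then (max ‖x.1 - y‖ |x.2|) ^ (-b) else 0) :=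
        lintegral_mono' Measure.restrict_le_self le_rfl
    _ = ∫⁻ s : ℝ, ENNReal.ofReal (if ‖s - 0‖ ≤ ρ then ‖s - 0‖ ^ (-a) else 0) *
      ∫⁻ z : Bdry n, ENNReal.ofReal (if max ‖z - y‖ |s| ≤ ρ then (max ‖z - y‖ |s|) ^ (-b) else 0) := by
        rw [Measure.volume_eq_prod, lintegral_prod_symm' _ hm]
        refine lintegral_congr fun s => ?_
        exact lintegral_const_mul' (ENNReal.ofReal (if ‖s - 0‖ ≤ ρ then ‖s - 0‖ ^ (-a) else 0)) _
          ENNReal.ofReal_ne_top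
    _ ≤ ∫⁻ s : ℝ, ENNReal.ofReal (if ‖s - 0‖ ≤ ρ then ‖s - 0‖ ^ (-a) else 0) *
      ENNReal.ofReal (C * ρ ^ ((n : ℝ) - 1 - b)) :=
        lintegral_mono fun s => mul_le_mul_right (h ρ hρ y s) _
    _ ≤ ENNReal.ofReal (D * ρ ^ (1 - a)) * ENNReal.ofReal (C * ρ ^ ((n : ℝ) - 1 - b)) := by
        rw [lintegral_mul_const' _ _ ENNReal.ofReal_ne_top]
        exact mul_le_mul_left (h' ρ hρ 0) _
    _ = _ := by
        rw [← ENNReal.ofReal_mul (by positivity),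
          show (n : ℝ) - a - b = (1 - a) + (n - 1 - b) by ring, Real.rpow_add hρ]
        congr 1
        ring

theorem lintegral_ofReal_ite_mul {Z : Type*} [MeasurableSpace Z] (σ : Measure Z) {c : ℝ}
    (hc : 0 ≤ c) (P : Z → Prop) [DecidablePred P] (φ : Z → ℝ) :
    ∫⁻ z, ENNReal.ofReal (if P z then c * φ z else 0) ∂σ =
      ENNReal.ofReal c * ∫⁻ z, ENNReal.ofReal (if P z then φ z else 0) ∂σ := by
  rw [← lintegral_const_mul' _ _ ENNReal.ofReal_ne_top]
  refine lintegral_congr fun z => ?_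
  rw [← ENNReal.ofReal_mul hc, mul_ite, mul_zero]

/-- A majorant of the form `σ ^ (-e) * φ` has integral at most `C` if the integral of `φ` is at
most `C * σ ^ e`. -/
theorem lintegral_ofReal_ite_mul_rpow_le {Z : Type*} [MeasurableSpace Z] (σ : Measure Z)
    {ρ e e' C : ℝ} (hρ : 0 < ρ) (he : e' = -e) (P : Z → Prop) [DecidablePred P] {φ : Z → ℝ}
    (h : ∫⁻ z, ENNReal.ofReal (if P z then φ z else 0) ∂σ ≤ ENNReal.ofReal (C * ρ ^ e)) :
    ∫⁻ z, ENNReal.ofReal (if P z then ρ ^ e' * φ z else 0) ∂σ ≤ ENNReal.ofReal C := by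
  rw [lintegral_ofReal_ite_mul σ (by positivity)]
  refine (mul_le_mul_right h _).trans (le_of_eq ?_)
  rw [← ENNReal.ofReal_mul (by positivity), he, mul_left_comm, ← Real.rpow_add hρ,
    neg_add_cancel, Real.rpow_zero, mul_one]

theorem lintegral_ofReal_add_le {Z : Type*} [MeasurableSpace Z] {σ : Measure Z} {φ ψ : Z → ℝ}
    (hφ : Measurable φ) {A B : ℝ} (hA : 0 ≤ A) (hB : 0 ≤ B)
    (h₁ : ∫⁻ z, ENNReal.ofReal (φ z) ∂σ ≤ ENNReal.ofReal A)
    (h₂ : ∫⁻ z, ENNReal.ofReal (ψ z) ∂σ ≤ ENNReal.ofReal B) :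
    ∫⁻ z, ENNReal.ofReal (φ z + ψ z) ∂σ ≤ ENNReal.ofReal (A + B) := by
  rw [ENNReal.ofReal_add hA hB]
  refine le_trans (lintegral_mono fun z => ENNReal.ofReal_add_le) ?_
  rw [lintegral_add_left (by fun_prop)]
  exact add_le_add h₁ h₂

end HalfSpaceIntegrals

/-! ### Boundedness of the Hardy–Littlewood–Sobolev form and the two Hardy forms. -/

section Forms

/-- The ansatz κ = η c solves both equations: c = nQ/(1+η) and ε = η d P. Then κ ≤ ηn and ε ≤ ηd, so
the choice η(n+d) = min(1,m)/2 gives the two upper bounds. -/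
theorem exists_hls_parameters {n d m P Q : ℝ} (hn : 0 < n) (hd : 0 < d) (hm : 0 < m) (hP : 0 < P)
    (hP1 : P < 1) (hQ : 0 < Q) (hQ1 : Q < 1) :
    ∃ κ c ε : ℝ, 0 ≤ κ ∧ 0 < c ∧ c = n * Q - κ ∧ ε * c = d * P * κ ∧ 0 < ε ∧ ε ≤ m ∧ κ + ε < 1 := by
  set η := min 1 m / (2 * (n + d)) with hη
  have h0 : 0 < min 1 m := lt_min one_pos hm
  have hη0 : 0 < η := by positivity
  have hη1 : η * (n + d) = min 1 m / 2 := by rw [hη]; field_simp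
  have hle1 := min_le_left 1 m
  have hle2 := min_le_right 1 m
  have hc : n * Q / (1 + η) ≤ n := by
    rw [div_le_iff₀ (by positivity)]
    nlinarith [mul_pos hn hη0, mul_pos hn hQ]
  have hc0 : 0 < n * Q / (1 + η) := by positivity
  have h1 : η * (n * Q / (1 + η)) ≤ η * n := by gcongr
  have h2 : η * d * P ≤ η * d := by nlinarith [mul_pos hη0 hd]
  refine ⟨η * (n * Q / (1 + η)), n * Q / (1 + η), η * d * P, by positivity, by positivity, ?_, ?_,
    by positivity, ?_, ?_⟩
  · field_simp
    ring
  · ring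
  · nlinarith [mul_pos hη0 hn]
  · nlinarith

/-- The case m = n - 1 is allowed, where r^(-m) has no uniform local integral over the boundary. The
exponent is therefore lowered to m - ε < n - 1, at the price of a factor xₙ^(-(κ+ε)) in the majorant
integrated over x, harmless since κ + ε < 1. -/
theorem unitFormBounded_bdryDist {n : ℕ} (hn : 2 ≤ n) {p p' q q' m : ℝ} (hp : p.HolderConjugate p')
    (hq : q.HolderConjugate q') (hm : m = ((n : ℝ) - 1) / p' + n / q) (hmn : m ≤ n - 1) :
    UnitFormBounded (halfVolume n) volume p q' fun x (y : Bdry n) => bdryDist x y ^ (-m) := by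
  have hn2 : (2 : ℝ) ≤ n := by exact_mod_cast hn
  have hd : (0 : ℝ) < n - 1 := by linarith
  have hn0 : (0 : ℝ) < n := by linarith
  have hp0 := hp.pos
  have hp'0 := hp.symm.pos
  have hq0 := hq.pos
  have hq'0 := hq.symm.pos
  have hm0 : 0 < m := by rw [hm]; positivity
  obtain ⟨κ, c, ε, hκ, hc, hcκ, hεc, hε, hεm, hκε⟩ := exists_hls_parameters hn0 hd hm0
    hp.one_div_pos (by rw [div_lt_one hp0]; exact hp.lt)
    hq.symm.one_div_pos (by rw [div_lt_one hq'0]; exact hq.symm.lt)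
  rw [mul_one_div] at hcκ hεc
  have e1 : m * p' = (n - 1) + n / q * p' := by rw [hm]; field_simp
  have e2 : m * q = n + (n - 1) / p' * q := by rw [hm]; field_simp; ring
  -- Each of the two summands of m leaves a positive excess over the critical exponent, so both
  -- tails converge.
  have b1 : (n : ℝ) - 1 < m * p' := by rw [e1]; linarith [show 0 < n / q * p' by positivity]
  have b2 : (n : ℝ) < m * q := by rw [e2]; linarith [show 0 < ((n : ℝ) - 1) / p' * q by positivity]
  obtain ⟨C₁, hC₁, h₁⟩ := exists_lintegral_bdryDist_tail_le hn b1
  obtain ⟨C₂, hC₂, h₂⟩ := exists_lintegral_halfVolume_bdryDist_tail_le hn b2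
  obtain ⟨C₃, hC₃, h₃⟩ := exists_lintegral_bdryDist_le hn (b := m - ε) (by linarith) (by linarith)
  obtain ⟨C₄, hC₄, h₄⟩ := exists_lintegral_halfVolume_bdryDist_le hn (a := κ + ε) (b := m - ε)
    hκε (by linarith) (by linarith)
  refine ⟨(1 + (C₁ + C₃)) + (C₂ + C₄), by positivity, fun F G hF hG hF0 hG0 hFi hGi => ?_⟩
  have hr := measurable_bdryDist (n := n)
  have hσ : Measurable fun x => G x ^ (-1 / (n : ℝ)) := hG.pow_const _
  have hτ : Measurable fun y => F y ^ (-1 / ((n : ℝ) - 1)) := hF.pow_const _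
  have hr₁ : Measurable fun z : Ambient n × Bdry n => bdryDist z.1 z.2 := hr
  have hτ₁ : Measurable fun z : Ambient n × Bdry n => F z.2 ^ (-1 / ((n : ℝ) - 1)) :=
    hτ.comp measurable_snd
  have hb₁ : Measurable fun z : Ambient n × Bdry n =>
      if F z.2 ^ (-1 / ((n : ℝ) - 1)) < bdryDist z.1 z.2 then
        (F z.2 ^ (-1 / ((n : ℝ) - 1))) ^ (m * q - n) * bdryDist z.1 z.2 ^ (-(m * q)) else 0 :=
    Measurable.ite (measurableSet_lt hτ₁ hr₁) ((hτ₁.pow_const _).mul (hr₁.pow_const _))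
      measurable_const
  have hb₂ : Measurable fun z : Ambient n × Bdry n =>
      if bdryDist z.1 z.2 ≤ F z.2 ^ (-1 / ((n : ℝ) - 1)) then
        (F z.2 ^ (-1 / ((n : ℝ) - 1))) ^ (-(n - (m + κ))) *
          (z.1.2 ^ (-(κ + ε)) * bdryDist z.1 z.2 ^ (-(m - ε))) else 0 :=
    Measurable.ite (measurableSet_le hr₁ hτ₁) ((hτ₁.pow_const _).mul
      (((measurable_snd.comp measurable_fst).pow_const _).mul (hr₁.pow_const _))) measurable_const
  refine lintegral_form_le_of_majorant (b := fun x y =>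
      (if F y ^ (-1 / ((n : ℝ) - 1)) < bdryDist x y then
        (F y ^ (-1 / ((n : ℝ) - 1))) ^ (m * q - n) * bdryDist x y ^ (-(m * q)) else 0) +
      (if bdryDist x y ≤ F y ^ (-1 / ((n : ℝ) - 1)) then
        (F y ^ (-1 / ((n : ℝ) - 1))) ^ (-(n - (m + κ))) *
          (x.2 ^ (-(κ + ε)) * bdryDist x y ^ (-(m - ε))) else 0))
    hp0 hq'0 hF hF0 hG0 hFi hGi (hb₁.add hb₂) (by positivity) (by positivity)
    ((ae_halfVolume_pos n).mono fun x hx => Filter.Eventually.of_forall fun y hf hg =>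
      hardyLittlewoodSobolev_pointwise_le hp hq hd hn0 hm hκ hc hcκ hεc hf hg hx
        ((le_abs_self _).trans (le_max_right _ _)))
    (Filter.Eventually.of_forall fun x hg => ?_) (Filter.Eventually.of_forall fun y hf => ?_)
  · have hs : 0 < G x ^ (-1 / (n : ℝ)) := Real.rpow_pos_of_pos hg _
    have hrx : Measurable fun y : Bdry n => bdryDist x y := hr.of_uncurry_left
    refine lintegral_ofReal_add_le hF one_pos.le (by positivity) (by simpa using hFi) ?_
    refine lintegral_ofReal_add_le ?_ hC₁ hC₃ ?_ ?_
    · exact Measurable.ite (measurableSet_lt measurable_const hrx)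
        ((hrx.pow_const _).const_mul _) measurable_const
    · exact lintegral_ofReal_ite_mul_rpow_le _ hs (by ring) _ (h₁ _ hs x)
    · exact lintegral_ofReal_ite_mul_rpow_le _ hs rfl _ (h₃ _ hs x)
  · have ht : 0 < F y ^ (-1 / ((n : ℝ) - 1)) := Real.rpow_pos_of_pos hf _
    refine lintegral_ofReal_add_le (hb₁.comp measurable_prodMk_right) hC₂ hC₄ ?_ ?_
    · exact lintegral_ofReal_ite_mul_rpow_le _ ht (by ring) _ (h₂ _ ht y)
    · exact lintegral_ofReal_ite_mul_rpow_le _ ht (by ring) _ (h₄ _ ht y)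

/-- The Hardy type form supported where the boundary point is closer to the origin. -/
theorem unitFormBounded_inner {n : ℕ} (hn : 2 ≤ n) {p p' q q' m a : ℝ}
    (hp : p.HolderConjugate p') (hq : q.HolderConjugate q') (hpq : 1 / q ≤ 1 / p)
    (hm : m = ((n : ℝ) - 1) / p' + n / q) (ha : a < ((n : ℝ) - 1) / p') :
    UnitFormBounded (halfVolume n) volume p q' fun x (y : Bdry n) =>
      if ‖y‖ < ‖x‖ then ‖y‖ ^ (-a) * ‖x‖ ^ (a - m) else 0 := by
  have := nontrivial_bdry hn
  have hp0 := hp.pos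
  have hp'0 := hp.symm.pos
  -- Half of the gap in `ha`: positive, so that powers of |y|/|x| < 1 gain decay, yet small enough
  -- to keep |y|^(-(a+δ)p') locally integrable.
  obtain ⟨δ, hδ0, hδ⟩ : ∃ δ, 0 < δ ∧ (a + δ) * p' < n - 1 := by
    refine ⟨(((n : ℝ) - 1) / p' - a) / 2, by linarith, ?_⟩
    rw [← lt_div_iff₀ hp'0]
    linarith
  obtain ⟨C₁, hC₁, h₁⟩ := exists_lintegral_norm_rpow_closedBall_le (volume : Measure (Bdry n))
    (b := (a + δ) * p') (by rwa [finrank_bdry hn])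
  obtain ⟨C₂, hC₂, h₂⟩ := exists_lintegral_norm_rpow_compl_ball_le (volume : Measure (Ambient n))
    (b := n + δ * p) (by rw [finrank_ambient hn]; nlinarith [mul_pos hδ0 hp0])
  rw [finrank_bdry hn] at h₁
  rw [finrank_ambient hn] at h₂
  refine ⟨(1 + C₁) + C₂, by positivity, fun F G hF hG hF0 hG0 hFi hGi => ?_⟩
  refine lintegral_form_le_of_majorant (a := fun x y => F y +
      if ‖y‖ ≤ ‖x‖ then ‖x‖ ^ ((a + δ) * p' - (n - 1)) * ‖y‖ ^ (-((a + δ) * p')) else 0)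
    (b := fun x y => if ‖y‖ < ‖x‖ then ‖y‖ ^ (δ * p) * ‖x‖ ^ (-(n + δ * p)) else 0)
    hp0 hq.symm.pos hF hF0 hG0 hFi hGi ?_ (by positivity) hC₂ ?_ ?_ ?_
  · refine Measurable.ite (measurableSet_lt (by fun_prop) (by fun_prop)) ?_ measurable_const
    exact (Measurable.pow_const (by fun_prop) _).mul (Measurable.pow_const (by fun_prop) _)
  · refine Filter.Eventually.of_forall fun x => ?_
    filter_upwards [Measure.ae_ne volume (0 : Bdry n)] with y hy hf hg
    have hy0 : 0 < ‖y‖ := norm_pos_iff.2 hy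
    by_cases h : ‖y‖ < ‖x‖
    · simp only [if_pos h, if_pos h.le]
      refine hardy_pointwise_le hp hq hpq hm hf hg (hy0.trans h) hy0 ?_
      exact Real.rpow_le_rpow hy0.le h.le (by positivity)
    · simp only [if_neg h, zero_mul, mul_zero, add_zero]
      have := hF0 y
      positivity
  · filter_upwards [ae_halfVolume_pos n] with x hx hg
    have hx0 : 0 < ‖x‖ := hx.trans_le ((le_abs_self _).trans (norm_snd_le x))
    refine lintegral_ofReal_add_le hF one_pos.le hC₁ (by simpa using hFi) ?_
    refine lintegral_ofReal_ite_mul_rpow_le _ hx0 (e := n - 1 - (a + δ) * p') (by ring) _ ?_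
    simpa using h₁ _ hx0 0
  · filter_upwards [Measure.ae_ne volume (0 : Bdry n)] with y hy hf
    have hy0 : 0 < ‖y‖ := norm_pos_iff.2 hy
    refine lintegral_ofReal_ite_mul_rpow_le _ hy0 (e := n - (n + δ * p)) (by ring) _ ?_
    refine (lintegral_mono' Measure.restrict_le_self le_rfl).trans ?_
    simpa using h₂ _ hy0 0

/-- The Hardy type form supported where the boundary point is farther from the origin. -/
theorem unitFormBounded_outer {n : ℕ} (hn : 2 ≤ n) {p p' q q' m a : ℝ}
    (hp : p.HolderConjugate p') (hq : q.HolderConjugate q') (hpq : 1 / q ≤ 1 / p)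
    (hm : m = ((n : ℝ) - 1) / p' + n / q) (ha : ((n : ℝ) - 1) / p' < a) :
    UnitFormBounded (halfVolume n) volume p q' fun x (y : Bdry n) =>
      if ‖x‖ < ‖y‖ then ‖y‖ ^ (-a) * ‖x‖ ^ (a - m) else 0 := by
  have := nontrivial_bdry hn
  have hp0 := hp.pos
  have hp'0 := hp.symm.pos
  -- Here δ is negative: the roles of ball and complement are exchanged, and |y|^(-(a+δ)p') must be
  -- integrable at infinity.
  obtain ⟨δ, hδ0, hδ⟩ : ∃ δ, δ < 0 ∧ n - 1 < (a + δ) * p' := by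
    refine ⟨(((n : ℝ) - 1) / p' - a) / 2, by linarith, ?_⟩
    rw [← div_lt_iff₀ hp'0]
    linarith
  have hδp : δ * p < 0 := mul_neg_of_neg_of_pos hδ0 hp0
  obtain ⟨C₁, hC₁, h₁⟩ := exists_lintegral_norm_rpow_compl_ball_le (volume : Measure (Bdry n))
    (b := (a + δ) * p') (by rwa [finrank_bdry hn])
  obtain ⟨C₂, hC₂, h₂⟩ := exists_lintegral_norm_rpow_closedBall_le (volume : Measure (Ambient n))
    (b := n + δ * p) (by rw [finrank_ambient hn]; linarith)
  rw [finrank_bdry hn] at h₁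
  rw [finrank_ambient hn] at h₂
  refine ⟨(1 + C₁) + C₂, by positivity, fun F G hF hG hF0 hG0 hFi hGi => ?_⟩
  refine lintegral_form_le_of_majorant (a := fun x y => F y +
      if ‖x‖ < ‖y‖ then ‖x‖ ^ ((a + δ) * p' - (n - 1)) * ‖y‖ ^ (-((a + δ) * p')) else 0)
    (b := fun x y => if ‖x‖ ≤ ‖y‖ then ‖y‖ ^ (δ * p) * ‖x‖ ^ (-(n + δ * p)) else 0)
    hp0 hq.symm.pos hF hF0 hG0 hFi hGi ?_ (by positivity) hC₂ ?_ ?_ ?_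
  · refine Measurable.ite (measurableSet_le (by fun_prop) (by fun_prop)) ?_ measurable_const
    exact (Measurable.pow_const (by fun_prop) _).mul (Measurable.pow_const (by fun_prop) _)
  · filter_upwards [ae_halfVolume_pos n] with x hx
    refine Filter.Eventually.of_forall fun y hf hg => ?_
    have hx0 : 0 < ‖x‖ := hx.trans_le ((le_abs_self _).trans (norm_snd_le x))
    by_cases h : ‖x‖ < ‖y‖
    · simp only [if_pos h, if_pos h.le]
      refine hardy_pointwise_le hp hq hpq hm hf hg hx0 (hx0.trans h) ?_
      exact Real.rpow_le_rpow_of_nonpos hx0 h.le hδp.le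
    · simp only [if_neg h, zero_mul, add_zero]
      split_ifs <;> positivity
  · filter_upwards [ae_halfVolume_pos n] with x hx hg
    have hx0 : 0 < ‖x‖ := hx.trans_le ((le_abs_self _).trans (norm_snd_le x))
    refine lintegral_ofReal_add_le hF one_pos.le hC₁ (by simpa using hFi) ?_
    refine lintegral_ofReal_ite_mul_rpow_le _ hx0 (e := n - 1 - (a + δ) * p') (by ring) _ ?_
    simpa using h₁ _ hx0 0
  · filter_upwards [Measure.ae_ne volume (0 : Bdry n)] with y hy hf
    have hy0 : 0 < ‖y‖ := norm_pos_iff.2 hy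
    refine lintegral_ofReal_ite_mul_rpow_le _ hy0 (e := n - (n + δ * p)) (by ring) _ ?_
    refine (lintegral_mono' Measure.restrict_le_self le_rfl).trans ?_
    simpa using h₂ _ hy0 0

end Forms

/-! ### Splitting the weighted kernel into the three model kernels. -/

theorem rpow_le_two_rpow_abs_mul {x y : ℝ} (s : ℝ) (hx : 0 < x) (hy : 0 < y) (hxy : x ≤ 2 * y)
    (hyx : y ≤ 2 * x) : y ^ s ≤ 2 ^ |s| * x ^ s := by
  rcases le_total 0 s with hs | hs
  · rw [abs_of_nonneg hs, ← Real.mul_rpow (by norm_num) hx.le]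
    exact Real.rpow_le_rpow hy.le hyx hs
  · rw [abs_of_nonpos hs, Real.rpow_neg (by norm_num), ← Real.inv_rpow (by norm_num),
      ← Real.mul_rpow (by norm_num) hx.le]
    exact Real.rpow_le_rpow_of_nonpos (by positivity) (by linarith) hs

theorem norm_le_euclNorm {n : ℕ} (x : Ambient n) : ‖x‖ ≤ euclNorm x := by
  refine Real.le_sqrt_of_sq_le ?_
  rcases max_cases ‖x.1‖ ‖x.2‖ with h | h <;> rw [Prod.norm_def, h.1]
  · linarith [sq_nonneg x.2]
  · rw [Real.norm_eq_abs, sq_abs]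
    linarith [sq_nonneg ‖x.1‖]

theorem euclNorm_le_two_mul_norm {n : ℕ} (x : Ambient n) : euclNorm x ≤ 2 * ‖x‖ := by
  refine Real.sqrt_le_iff.2 ⟨by positivity, ?_⟩
  have h1 := pow_le_pow_left₀ (norm_nonneg _) (norm_fst_le x) 2
  have h2 := pow_le_pow_left₀ (norm_nonneg _) (norm_snd_le x) 2
  rw [Real.norm_eq_abs, sq_abs] at h2
  nlinarith [sq_nonneg ‖x‖]

theorem norm_le_bdryDist_add_norm {n : ℕ} (x : Ambient n) (y : Bdry n) :
    ‖x‖ ≤ bdryDist x y + ‖y‖ := by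
  have h := norm_sub_norm_le x (y, 0)
  rw [bdryDist_eq_norm]
  simp only [Prod.norm_mk, norm_zero, norm_nonneg, sup_of_le_left] at h
  linarith

theorem norm_le_bdryDist_add_norm' {n : ℕ} (x : Ambient n) (y : Bdry n) :
    ‖y‖ ≤ bdryDist x y + ‖x‖ := by
  have h := norm_sub_norm_le (y, (0 : ℝ)) x
  rw [bdryDist_eq_norm, norm_sub_rev]
  simp only [Prod.norm_mk, norm_zero, norm_nonneg, sup_of_le_left] at h
  linarith

theorem bdryDist_le_norm_add_norm {n : ℕ} (x : Ambient n) (y : Bdry n) :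
    bdryDist x y ≤ ‖x‖ + ‖y‖ := by
  have h := norm_sub_le x (y, (0 : ℝ))
  rw [bdryDist_eq_norm]
  simpa only [Prod.norm_mk, norm_zero, norm_nonneg, sup_of_le_left] using h

theorem kernelP_le {n : ℕ} {lam μ : ℝ} (hμ : 0 ≤ μ) {x : Ambient n} (hx : 0 < x.2) (y : Bdry n) :
    kernelP lam μ x y ≤ x.2 ^ lam * bdryDist x y ^ (-μ) := by
  have hr : 0 < bdryDist x y := hx.trans_le ((le_abs_self _).trans (le_max_right _ _))
  rw [kernelP, div_eq_mul_inv, Real.rpow_neg hr.le]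
  gcongr
  calc bdryDist x y ^ μ = (bdryDist x y ^ 2) ^ (μ / 2) := by
        rw [← Real.rpow_natCast, ← Real.rpow_mul hr.le]
        congr 1
        push_cast
        ring
    _ ≤ _ := by
        refine Real.rpow_le_rpow (by positivity) ?_ (by positivity)
        rw [bdryDist]
        rcases max_cases ‖x.1 - y‖ |x.2| with h | h <;> rw [h.1]
        · linarith [sq_nonneg x.2]
        · rw [sq_abs]
          linarith [sq_nonneg ‖x.1 - y‖]

theorem weightedKernel_nonneg {n : ℕ} {α β lam μ : ℝ} {x : Ambient n} (hx : 0 < x.2)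
    (y : Bdry n) : 0 ≤ weightedKernel α β lam μ x y := by
  unfold weightedKernel kernelP euclNorm
  positivity

theorem measurable_weightedKernel {n : ℕ} (α β lam μ : ℝ) :
    Measurable (Function.uncurry (weightedKernel (n := n) α β lam μ)) := by
  unfold weightedKernel kernelP euclNorm Function.uncurry
  refine ((Measurable.pow_const (by fun_prop) _).mul
    ((Measurable.pow_const (by fun_prop) _).div (Measurable.pow_const (by fun_prop) _))).mul
    (Measurable.pow_const (by fun_prop) _)

/-- The regions |y| > 2|x|, |x| > 2|y| and |x| ~ |y| each use one summand, the other two being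
nonnegative. The constant multiplies the losses of all regions; every factor is at least 1. -/
theorem weightedKernel_le {n : ℕ} {α β lam μ m : ℝ} (hlam : 0 ≤ lam) (hμ : 0 ≤ μ)
    (hαβ : 0 ≤ α + β) (hm : m = α + β + μ - lam) {x : Ambient n} (hx : 0 < x.2) {y : Bdry n}
    (hy : y ≠ 0) :
    |weightedKernel α β lam μ x y| ≤ (2 ^ |α| * 2 ^ |β| * 2 ^ μ * 3 ^ (α + β)) *
      ((if ‖x‖ < ‖y‖ then ‖y‖ ^ (-(α + μ)) * ‖x‖ ^ ((α + μ) - m) else 0) +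
        (if ‖y‖ < ‖x‖ then ‖y‖ ^ (-α) * ‖x‖ ^ (α - m) else 0) + bdryDist x y ^ (-m)) := by
  rw [abs_of_nonneg (weightedKernel_nonneg hx y)]
  have hx0 : 0 < ‖x‖ := hx.trans_le ((le_abs_self _).trans (norm_snd_le x))
  have hxt : x.2 ≤ ‖x‖ := (le_abs_self _).trans (norm_snd_le x)
  have hrt : x.2 ≤ bdryDist x y := (le_abs_self _).trans (le_max_right _ _)
  have hr0 : 0 < bdryDist x y := hx.trans_le hrt
  have hy0 : 0 < ‖y‖ := norm_pos_iff.2 hy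
  have hE0 : 0 < euclNorm x := hx0.trans_le (norm_le_euclNorm x)
  have hβ : euclNorm x ^ (-β) ≤ 2 ^ |β| * ‖x‖ ^ (-β) := by
    rw [← abs_neg β]
    exact rpow_le_two_rpow_abs_mul _ hx0 hE0 (by linarith [norm_le_euclNorm x])
      (euclNorm_le_two_mul_norm x)
  have hK : weightedKernel α β lam μ x y ≤
      ‖y‖ ^ (-α) * (x.2 ^ lam * bdryDist x y ^ (-μ)) * (2 ^ |β| * ‖x‖ ^ (-β)) := by
    unfold weightedKernel
    gcongr
    exact kernelP_le hμ hx y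
  have a1 : (1 : ℝ) ≤ 2 ^ |α| := Real.one_le_rpow (by norm_num) (abs_nonneg _)
  have a2 : (1 : ℝ) ≤ 2 ^ |β| := Real.one_le_rpow (by norm_num) (abs_nonneg _)
  have a3 : (1 : ℝ) ≤ 2 ^ μ := Real.one_le_rpow (by norm_num) hμ
  have a4 : (1 : ℝ) ≤ 3 ^ (α + β) := Real.one_le_rpow (by norm_num) hαβ
  set A : ℝ := 2 ^ |α|
  set B : ℝ := 2 ^ |β|
  set M : ℝ := 2 ^ μ
  set D : ℝ := 3 ^ (α + β)
  have hAD : 1 ≤ A * D := one_le_mul_of_one_le_of_one_le a1 a4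
  have half : ∀ s : ℝ, 0 < s → s ≤ 2 * bdryDist x y → bdryDist x y ^ (-μ) ≤ M * s ^ (-μ) := by
    intro s hs h
    calc bdryDist x y ^ (-μ) ≤ (2⁻¹ * s) ^ (-μ) :=
          Real.rpow_le_rpow_of_nonpos (by positivity) (by linarith) (by linarith)
      _ = M * s ^ (-μ) := by
          rw [Real.mul_rpow (by norm_num) hs.le, Real.inv_rpow (by norm_num),
            Real.rpow_neg (by norm_num), inv_inv]
  have hN1 : 0 ≤ if ‖x‖ < ‖y‖ then ‖y‖ ^ (-(α + μ)) * ‖x‖ ^ ((α + μ) - m) else 0 := by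
    split_ifs <;> positivity
  have hN2 : 0 ≤ if ‖y‖ < ‖x‖ then ‖y‖ ^ (-α) * ‖x‖ ^ (α - m) else 0 := by
    split_ifs <;> positivity
  have hN3 : 0 ≤ bdryDist x y ^ (-m) := by positivity
  refine hK.trans ?_
  have hxl : x.2 ^ lam ≤ ‖x‖ ^ lam := Real.rpow_le_rpow hx.le hxt hlam
  -- Here r ≥ |y| - |x| ≥ |y|/2, so r^(-μ) costs a factor 2^μ, and xₙ^λ ≤ |x|^λ.
  by_cases c1 : 2 * ‖x‖ < ‖y‖
  · have h1 : ‖x‖ < ‖y‖ := by linarith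
    calc ‖y‖ ^ (-α) * (x.2 ^ lam * bdryDist x y ^ (-μ)) * (B * ‖x‖ ^ (-β))
        ≤ ‖y‖ ^ (-α) * (‖x‖ ^ lam * (M * ‖y‖ ^ (-μ))) * (B * ‖x‖ ^ (-β)) := by
          gcongr
          exact half _ hy0 (by linarith [norm_le_bdryDist_add_norm' x y])
      _ = (B * M) * (‖y‖ ^ (-(α + μ)) * ‖x‖ ^ ((α + μ) - m)) := by
          rw [neg_add, Real.rpow_add hy0, show α + μ - m = lam + -β by rw [hm]; ring,
            Real.rpow_add hx0]
          ring
      _ ≤ (A * B * M * D) * (‖y‖ ^ (-(α + μ)) * ‖x‖ ^ ((α + μ) - m)) := by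
          refine mul_le_mul_of_nonneg_right ?_ (by positivity)
          calc B * M = 1 * (B * M) := by ring
            _ ≤ (A * D) * (B * M) := by gcongr
            _ = A * B * M * D := by ring
      _ ≤ _ := by
          rw [if_pos h1] at hN1 ⊢
          gcongr
          linarith
  by_cases c2 : 2 * ‖y‖ < ‖x‖
  · have h1 : ‖y‖ < ‖x‖ := by linarith
    calc ‖y‖ ^ (-α) * (x.2 ^ lam * bdryDist x y ^ (-μ)) * (B * ‖x‖ ^ (-β))
        ≤ ‖y‖ ^ (-α) * (‖x‖ ^ lam * (M * ‖x‖ ^ (-μ))) * (B * ‖x‖ ^ (-β)) := by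
          gcongr
          exact half _ hx0 (by linarith [norm_le_bdryDist_add_norm x y])
      _ = (B * M) * (‖y‖ ^ (-α) * ‖x‖ ^ (α - m)) := by
          rw [show α - m = lam + -μ + -β by rw [hm]; ring, Real.rpow_add hx0, Real.rpow_add hx0]
          ring
      _ ≤ (A * B * M * D) * (‖y‖ ^ (-α) * ‖x‖ ^ (α - m)) := by
          refine mul_le_mul_of_nonneg_right ?_ (by positivity)
          calc B * M = 1 * (B * M) := by ring
            _ ≤ (A * D) * (B * M) := by gcongr
            _ = A * B * M * D := by ring
      _ ≤ _ := by
          rw [if_pos h1] at hN2 ⊢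
          gcongr
          linarith
  · have hα : ‖y‖ ^ (-α) ≤ A * ‖x‖ ^ (-α) := by
      have h := rpow_le_two_rpow_abs_mul (-α) hx0 hy0 (not_lt.1 c2) (not_lt.1 c1)
      rwa [abs_neg] at h
    -- Comparability gives r ≤ |x| + |y| ≤ 3|x|; the sign of α + β lets r replace |x|.
    have hxr : ‖x‖ ^ (-(α + β)) ≤ D * bdryDist x y ^ (-(α + β)) := by
      calc ‖x‖ ^ (-(α + β)) ≤ (3⁻¹ * bdryDist x y) ^ (-(α + β)) :=
            Real.rpow_le_rpow_of_nonpos (by positivity)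
              (by linarith [bdryDist_le_norm_add_norm x y]) (by linarith)
        _ = D * bdryDist x y ^ (-(α + β)) := by
            rw [Real.mul_rpow (by norm_num) hr0.le, Real.inv_rpow (by norm_num),
              Real.rpow_neg (by norm_num), inv_inv]
    calc ‖y‖ ^ (-α) * (x.2 ^ lam * bdryDist x y ^ (-μ)) * (B * ‖x‖ ^ (-β))
        ≤ (A * ‖x‖ ^ (-α)) * (bdryDist x y ^ lam * bdryDist x y ^ (-μ)) *
            (B * ‖x‖ ^ (-β)) := by gcongr
      _ = A * B * ‖x‖ ^ (-(α + β)) * (bdryDist x y ^ lam * bdryDist x y ^ (-μ)) := by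
          rw [neg_add, Real.rpow_add hx0]
          ring
      _ ≤ A * B * (D * bdryDist x y ^ (-(α + β))) *
            (bdryDist x y ^ lam * bdryDist x y ^ (-μ)) := by gcongr
      _ = 1 * (A * B * D) * bdryDist x y ^ (-m) := by
          rw [show -m = -(α + β) + (lam + -μ) by rw [hm]; ring, Real.rpow_add hr0,
            Real.rpow_add hr0]
          ring
      _ ≤ M * (A * B * D) * bdryDist x y ^ (-m) := by gcongr
      _ = (A * B * M * D) * bdryDist x y ^ (-m) := by ring
      _ ≤ _ := by
          gcongr
          linarith

/-! ### Assembly of the inequality and its equivalent forms. -/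

theorem exists_isBoundedForm_weightedKernel {n : ℕ} (hn : 2 ≤ n) {p p' q q' α β lam μ : ℝ}
    (hp : p.HolderConjugate p') (hq : q.HolderConjugate q') (hlam : 0 ≤ lam) (hμ : 0 ≤ μ)
    (hpq : (n : ℝ) / q ≤ ((n : ℝ) - 1) / p)
    (hscale : α + β + μ - lam = ((n : ℝ) - 1) / p' + n / q)
    (hα : α < ((n : ℝ) - 1) / p') (hβ : β < n / q + lam) (hαβ : 0 ≤ α + β) :
    ∃ C : ℝ, 0 < C ∧
      IsBoundedForm (halfVolume n) volume (weightedKernel (n := n) α β lam μ) p q' C := by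
  have hn2 : (2 : ℝ) ≤ n := by exact_mod_cast hn
  have := nontrivial_bdry hn
  have hip : 1 / p + 1 / p' = 1 := by simpa using hp.inv_add_inv_eq_one
  have hpq' : 1 / q ≤ 1 / p := by
    rw [div_eq_mul_one_div, div_eq_mul_one_div _ p] at hpq
    nlinarith [hp.one_div_pos]
  -- Replacing n/q by the larger (n-1)/p in the scaling identity gives (n-1)(1/p + 1/p') = n - 1.
  have hmn : α + β + μ - lam ≤ n - 1 := by
    have : ((n : ℝ) - 1) / p + (n - 1) / p' = n - 1 := by
      rw [div_eq_mul_one_div, div_eq_mul_one_div _ p', ← mul_add, hip, mul_one]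
    linarith
  refine UnitFormBounded.exists_isBoundedForm (measurable_weightedKernel α β lam μ) hp.pos
    hq.symm.pos ?_
  have hout : Measurable (Function.uncurry fun (x : Ambient n) (y : Bdry n) =>
      if ‖x‖ < ‖y‖ then ‖y‖ ^ (-(α + μ)) * ‖x‖ ^ ((α + μ) - (α + β + μ - lam)) else 0) :=
    Measurable.ite (measurableSet_lt (by fun_prop) (by fun_prop))
      ((Measurable.pow_const (by fun_prop) _).mul (Measurable.pow_const (by fun_prop) _))
      measurable_const
  have hin : Measurable (Function.uncurry fun (x : Ambient n) (y : Bdry n) =>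
      if ‖y‖ < ‖x‖ then ‖y‖ ^ (-α) * ‖x‖ ^ (α - (α + β + μ - lam)) else 0) :=
    Measurable.ite (measurableSet_lt (by fun_prop) (by fun_prop))
      ((Measurable.pow_const (by fun_prop) _).mul (Measurable.pow_const (by fun_prop) _))
      measurable_const
  -- The outer Hardy form needs α + μ > (n-1)/p'; by scaling α + μ = (n-1)/p' + n/q + λ - β, so this
  -- is the bound on β.
  refine UnitFormBounded.of_le_mul
    (((unitFormBounded_outer hn hp hq hpq' hscale (a := α + μ) (by linarith)).add
      (unitFormBounded_inner hn hp hq hpq' hscale hα) hout).add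
      (unitFormBounded_bdryDist hn hp hq hscale hmn) (hout.add hin))
    (c := 2 ^ |α| * 2 ^ |β| * 2 ^ μ * 3 ^ (α + β)) (by positivity) ?_
  filter_upwards [ae_halfVolume_pos n] with x hx
  filter_upwards [Measure.ae_ne volume (0 : Bdry n)] with y hy
  exact weightedKernel_le hlam hμ hαβ rfl hx hy

theorem theorem1p1 (n : ℕ) (hn : 3 ≤ n) (p p' q q' α β lam μ : ℝ)
    (hp1 : 1 < p) (hq1 : 1 < q')
    (hp : p.HolderConjugate p') (hq : q.HolderConjugate q')
    (hlam : 0 ≤ lam)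
    (hpq : 1 ≤ ((n : ℝ) - 1) / n * (1 / p) + 1 / q')
    (hμ0 : 0 < μ) (hμ1 : μ < n - 2 * lam)
    (hμ2 : (μ - 2 * lam) / (2 * n) + μ / (2 * ((n : ℝ) - 1)) < 1)
    (hscale : ((n : ℝ) - 1) / n * (1 / p) + 1 / q' + (α + β + μ - lam) / n
      = (2 * (n : ℝ) - 1) / n)
    (hα : α < ((n : ℝ) - 1) / p')
    (hβ : β < (n + lam * q) / q)
    (hαβ : 0 ≤ α + β) :
    (∃ C : ℝ, 0 < C ∧ BilinearBound n α β lam μ p q' C ∧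
      VBound n α β lam μ p q C ∧ WBound n α β lam μ p' q' C) ∧
    (∀ C : ℝ, 0 < C →
      (BilinearBound n α β lam μ p q' C ↔ VBound n α β lam μ p q C) ∧
      (BilinearBound n α β lam μ p q' C ↔ WBound n α β lam μ p' q' C)) := by
  have hn3 : (3 : ℝ) ≤ n := by exact_mod_cast hn
  have hn0 : (0 : ℝ) < n := by linarith
  have hip : 1 / p + 1 / p' = 1 := by simpa using hp.inv_add_inv_eq_one
  have hiq : 1 / q + 1 / q' = 1 := by simpa using hq.inv_add_inv_eq_one
  have hk := measurable_weightedKernel (n := n) α β lam μ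
  have hk0 : ∀ᵐ z ∂(halfVolume n).prod (volume : Measure (Bdry n)),
      0 ≤ weightedKernel α β lam μ z.1 z.2 :=
    (Measure.quasiMeasurePreserving_fst.ae (ae_halfVolume_pos n)).mono
      fun z hz => weightedKernel_nonneg hz z.2
  -- `BilinearBound`, `VBound` and `WBound` are by definition the abstract form and operator bounds
  -- for `weightedKernel`, with X the half space and Y its boundary.
  have hV : ∀ C : ℝ, 0 < C → (BilinearBound n α β lam μ p q' C ↔ VBound n α β lam μ p q C) :=
    fun C hC => isBoundedForm_iff_isBoundedIntegralOperator hk hk0 hq hC.le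
  have hW : ∀ C : ℝ, 0 < C → (BilinearBound n α β lam μ p q' C ↔ WBound n α β lam μ p' q' C) :=
    fun C hC => isBoundedForm_iff_isBoundedIntegralOperator_swap hk hk0 hp hC.le
  refine ⟨?_, fun C hC => ⟨hV C hC, hW C hC⟩⟩
  have h1 : (n : ℝ) / q ≤ ((n : ℝ) - 1) / p := by
    have h := mul_le_mul_of_nonneg_left hpq hn0.le
    have e : (n : ℝ) * (((n : ℝ) - 1) / n * (1 / p) + 1 / q') = (n - 1) / p + n * (1 / q') := by
      field_simp
    rw [e, eq_sub_of_add_eq' hiq, mul_sub, mul_one_div] at h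
    linarith
  have h2 : α + β + μ - lam = ((n : ℝ) - 1) / p' + n / q := by
    have h := congrArg (fun s => (n : ℝ) * s) hscale
    have e : (n : ℝ) * (((n : ℝ) - 1) / n * (1 / p) + 1 / q' + (α + β + μ - lam) / n) =
        (n - 1) * (1 / p) + n * (1 / q') + (α + β + μ - lam) := by
      field_simp
    have e' : (n : ℝ) * ((2 * (n : ℝ) - 1) / n) = 2 * n - 1 := by field_simp
    simp only [e, e'] at h
    rw [div_eq_mul_one_div (n : ℝ) q, div_eq_mul_one_div _ p']
    linear_combination h - (n - 1) * hip - n * hiq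
  have h3 : β < n / q + lam := by
    rwa [add_div, mul_div_cancel_right₀ _ hq.ne_zero] at hβ
  obtain ⟨C, hC, H⟩ := exists_isBoundedForm_weightedKernel (by omega) hp hq hlam hμ0.le h1 h2 hα h3
    hαβ
  exact ⟨C, hC, H, (hV C hC).1 H, (hW C hC).1 H⟩
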